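/- There is an absolute constant $C$, and for every $\alpha\in(0,1)$ there are constants $c>0$ and $d_0$ depending only on $\alpha$, such that the following holds for all integers $K\ge 2$ and $d\ge d_0$ with $K\le d^{\alpha}$ and all $0<\gamma\le K^{-C}$. Let $\mathcal L_{d,K}$ be the class of $K$-class linear classifiers $f(\mathbf x)=\mathrm{argmax}_{i\in[K]}(\mathbf w^{(i)}\cdot\mathbf x+t_i)$ on $\mathbb R^d$, with ties resolved by the smallest index. A partial label distribution for $f\in\mathcal L_{d,K}$ with parameter $\gamma$ is a distribution $D$ of pairs $(\mathbf x,S)\in\mathbb R^d\times 2^{[K]}$ for which there is a row-stochastic matrix $\mathbf H\in\mathbb R^{[K]\times 2^{[K]}}$ with $\Pr[S=T\mid\mathbf x]=\mathbf H_{f(\mathbf x),T}$ for all $\mathbf x$ and $T$, with $\mathbf H_{i,T}=0$ whenever $i\notin T$, and with $\sum_{T\not\ni y}\mathbf H_{f(\mathbf x),T}\ge\gamma$ for all $\mathbf x$ and all $y\ne f(\mathbf x)$. It is a contrastive label distribution if $\mathbf H$ can moreover be chosen with $\mathbf H_{i,T}=0$ whenever $|T|\ne K-1$. A query to $\mathrm{VSTAT}(u)$,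 $u>0$, is a measurable function $q:\mathbb R^d\times 2^{[K]}\to[-1,1]$; a valid oracle for $D$ answers it by a number within $\max\bigl(1/u,\sqrt{\mathrm{Var}_D[q]/u}\bigr)$ of $\mathbb E_D[q]$. An SQ algorithm asks adaptively chosen queries, with parameters $u$ of its choice, and may be randomized. Consider any SQ algorithm that learns $\mathcal L_{d,K}$ from partial labels with parameter $\gamma$ under the standard Gaussian to error $1/(2K)$; that is, for every $f\in\mathcal L_{d,K}$, every partial label distribution $D$ for $f$ with parameter $\gamma$ and $\mathbf x$-marginal $\mathcal N(\mathbf 0,\mathbf I)$, and every valid oracle for $D$ (a fixed function of the query and of $u$), it outputs with probability at least $2/3$ a measurable $h:\mathbb R^d\to[K]$ with $\Pr_{\mathbf x\sim\mathcal N(\mathbf 0,\mathbf I)}[h(\mathbf x)\neq f(\mathbf x)]\le 1/(2K)$. Then the algorithm requires either $2^{d^{c}}$ queries or at least one query to $\mathrm{VSTAT}(u)$ with $u\ge d^{cK}$: for some such $f$ and $D$ and some valid oracle for $D$, with positive probability it makes at least $2^{d^{c}}$ queries or makes a query to $\mathrm{VSTAT}(u)$ with $u\ge d^{cK}$. The same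 holds when partial label distributions are replaced throughout by contrastive label distributions. -/

import Mathlib

open MeasureTheory ProbabilityTheory
open scoped ENNReal

universe u

/-! ### Statistical query algorithms -/

/-- A statistical query on `X`: a (measurable) function `q : X → [-1, 1]`. -/
structure StatQuery (X : Type*) [MeasurableSpace X] where
  toFun : X → ℝ
  measurable_toFun : Measurable toFun
  mem_Icc : ∀ x, toFun x ∈ Set.Icc (-1 : ℝ) 1

/-- An oracle answers a query `q` asked with parameter `u > 0` by a real number. -/
abbrev SQOracle (X : Type*) [MeasurableSpace X] : Type _ :=
  StatQuery X → {u : ℝ // 0 < u} → ℝ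

/-- `O` is a valid `VSTAT` oracle for the distribution `D`: for every `u > 0`, the answer to `q` at
parameter `u` is within `max (1/u, √(Var_D[q] / u))` of `E_D[q]`. -/
def IsVSTAT {X : Type*} [MeasurableSpace X] (D : Measure X) (O : SQOracle X) : Prop :=
  ∀ (q : StatQuery X) (u : {u : ℝ // 0 < u}),
    |O q u - ∫ x, q.toFun x ∂D| ≤ max (1 / (u : ℝ)) (Real.sqrt (variance q.toFun D / (u : ℝ)))

/-- A deterministic SQ algorithm on `X` with outputs in `H`: either it stops and outputs an element
of `H`, or it asks a query `q` to `VSTAT(u)` for some `u > 0` of its choice and continues in a way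
that depends arbitrarily on the answer. -/
inductive SQAlgorithm (X : Type*) [MeasurableSpace X] (H : Type*) where
  | output (h : H) : SQAlgorithm X H
  | query (q : StatQuery X) (u : {u : ℝ // 0 < u}) (next : ℝ → SQAlgorithm X H) : SQAlgorithm X H

namespace SQAlgorithm

variable {X : Type*} [MeasurableSpace X] {H : Type*}

/-- The output of the algorithm when its queries are answered by `O`. -/
def run (O : SQOracle X) : SQAlgorithm X H → H
  | output h => h
  | query q u next => run O (next (O q u))

/-- The list of queries, with their parameters, that the algorithm asks when answered by `O`. -/
def queries (O : SQOracle X) : SQAlgorithm X H → List (StatQuery X × {u : ℝ // 0 < u})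
  | output _ => []
  | query q u next => (q, u) :: queries O (next (O q u))

end SQAlgorithm

/-! ### Multiclass linear classifiers and partial labels -/

/-- `f` is a `K`-class linear classifier on `ℝ^d`: `f x = argmax_i (w⁽ⁱ⁾ · x + t_i)`, where ties are
resolved by selecting the smallest index. -/
def IsLinearClassifier {d K : ℕ} (f : EuclideanSpace ℝ (Fin d) → Fin K) : Prop :=
  ∃ (w : Fin K → EuclideanSpace ℝ (Fin d)) (t : Fin K → ℝ), ∀ x,
    (∀ j, inner ℝ (w j) x + t j ≤ inner ℝ (w (f x)) x + t (f x)) ∧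
    (∀ j, j < f x → inner ℝ (w j) x + t j < inner ℝ (w (f x)) x + t (f x))

/-- `H` is a confusion matrix for partial labels of `f` with parameter `γ`: it is row stochastic,
the observed set always contains the true label, and every wrong label is missing from the observed
set with probability at least `γ`. -/
structure IsConfusionMatrix {d K : ℕ} (f : EuclideanSpace ℝ (Fin d) → Fin K) (γ : ℝ)
    (H : Matrix (Fin K) (Finset (Fin K)) ℝ) : Prop where
  nonneg : ∀ i S, 0 ≤ H i S
  row_sum : ∀ i, ∑ S, H i S = 1
  eq_zero : ∀ i S, i ∉ S → H i S = 0
  le_missing : ∀ x y, y ≠ f x → γ ≤ ∑ S with y ∉ S, H (f x) S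

/-- Under `D`, the conditional law of the label set is `Pr[S = T | x] = H (f x) T`. -/
def HasConfusionMatrix {d K : ℕ} (D : Measure (EuclideanSpace ℝ (Fin d) × Finset (Fin K)))
    (f : EuclideanSpace ℝ (Fin d) → Fin K) (H : Matrix (Fin K) (Finset (Fin K)) ℝ) : Prop :=
  ∀ (A : Set (EuclideanSpace ℝ (Fin d))) (T : Finset (Fin K)), MeasurableSet A →
    D (A ×ˢ {T}) = ∫⁻ x in A, ENNReal.ofReal (H (f x) T) ∂(D.map Prod.fst)

/-- The pairs `(D, f)` where `f` is a `K`-class linear classifier and `D` is a partial label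
distribution for `f` with parameter `γ` whose `x`-marginal is the standard Gaussian. -/
def partialLabelInstances (d K : ℕ) (γ : ℝ) :
    Set (Measure (EuclideanSpace ℝ (Fin d) × Finset (Fin K)) ×
      (EuclideanSpace ℝ (Fin d) → Fin K)) :=
  {p | IsLinearClassifier p.2 ∧
    p.1.map Prod.fst = stdGaussian (EuclideanSpace ℝ (Fin d)) ∧
    ∃ H, IsConfusionMatrix p.2 γ H ∧ HasConfusionMatrix p.1 p.2 H}

/-- The contrastive special case: the observed set is always the complement of a single (wrong)
label, so observing it is the same as observing that label. -/
def contrastiveLabelInstances (d K : ℕ) (γ : ℝ) :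
    Set (Measure (EuclideanSpace ℝ (Fin d) × Finset (Fin K)) ×
      (EuclideanSpace ℝ (Fin d) → Fin K)) :=
  {p | IsLinearClassifier p.2 ∧
    p.1.map Prod.fst = stdGaussian (EuclideanSpace ℝ (Fin d)) ∧
    ∃ H, IsConfusionMatrix p.2 γ H ∧ (∀ i S, S.card + 1 ≠ K → H i S = 0) ∧
      HasConfusionMatrix p.1 p.2 H}

/-- A hypothesis: a measurable function `ℝ^d → [K]`. -/
abbrev Hypothesis (d K : ℕ) : Type :=
  {h : EuclideanSpace ℝ (Fin d) → Fin K // Measurable h}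

/-- The randomized SQ algorithm `A` (with random seed `ω ∼ μ`) learns the instances `I` to error
`ε`: for every `(D, f) ∈ I` and every valid oracle for `D`, with probability at least `2/3` it
outputs a hypothesis `h` with `Pr_{x ∼ N(0, I)}[h x ≠ f x] ≤ ε`. -/
def LearnsToError {d K : ℕ} {Ω : Type*} [MeasurableSpace Ω] (μ : Measure Ω)
    (A : Ω → SQAlgorithm (EuclideanSpace ℝ (Fin d) × Finset (Fin K)) (Hypothesis d K))
    (I : Set (Measure (EuclideanSpace ℝ (Fin d) × Finset (Fin K)) ×
      (EuclideanSpace ℝ (Fin d) → Fin K))) (ε : ℝ) : Prop :=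
  ∀ D f, (D, f) ∈ I → ∀ O, IsVSTAT D O →
    ∃ G : Set Ω, MeasurableSet G ∧ (2 / 3 : ℝ≥0∞) ≤ μ G ∧ ∀ ω ∈ G,
      stdGaussian (EuclideanSpace ℝ (Fin d)) {x | ((A ω).run O).1 x ≠ f x} ≤ ENNReal.ofReal ε

/-- Any randomized SQ algorithm that learns the instances `I` to error `ε` requires either at least
`N` queries or at least one query to `VSTAT(u)` with `u ≥ U`: on some instance in `I` and some valid
oracle for it, with positive probability, it makes at least `N` queries or such a query. -/
def LearningRequires {d K : ℕ}
    (I : Set (Measure (EuclideanSpace ℝ (Fin d) × Finset (Fin K)) ×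
      (EuclideanSpace ℝ (Fin d) → Fin K))) (ε N U : ℝ) : Prop :=
  ∀ (Ω : Type u) [MeasurableSpace Ω] (μ : Measure Ω) [IsProbabilityMeasure μ]
    (A : Ω → SQAlgorithm (EuclideanSpace ℝ (Fin d) × Finset (Fin K)) (Hypothesis d K)),
    LearnsToError μ A I ε →
      ∃ D f, (D, f) ∈ I ∧ ∃ O, IsVSTAT D O ∧
        0 < μ {ω | N ≤ (((A ω).queries O).length : ℝ) ∨
          ∃ p ∈ (A ω).queries O, U ≤ (p.2 : ℝ)}

/-! ### The standard Gaussian on the complex plane -/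

lemma stdGaussian_complex_eq_map_prod :
    stdGaussian ℂ = ((gaussianReal 0 1).prod (gaussianReal 0 1)).map
      (fun p : ℝ × ℝ => (⟨p.1, p.2⟩ : ℂ)) := by
  have hm : Measurable (fun p : ℝ × ℝ => (⟨p.1, p.2⟩ : ℂ)) :=
    Complex.measurableEquivRealProd.symm.measurable
  have := Measure.isProbabilityMeasure_map (μ := (gaussianReal 0 1).prod (gaussianReal 0 1))
    hm.aemeasurable
  apply Measure.ext_of_charFun
  ext t
  rw [charFun_stdGaussian, charFun_apply, integral_map hm.aemeasurable (by fun_prop)]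
  have h (p : ℝ × ℝ) : Complex.exp ((inner ℝ (⟨p.1, p.2⟩ : ℂ) t : ℝ) * Complex.I) =
      Complex.exp (t.re * p.1 * Complex.I) * Complex.exp (t.im * p.2 * Complex.I) := by
    rw [← Complex.exp_add, Complex.inner]
    congr 1
    simp
    ring
  simp_rw [h]
  rw [integral_prod_mul (fun x : ℝ => Complex.exp (t.re * x * Complex.I))
    (fun x : ℝ => Complex.exp (t.im * x * Complex.I)), ← charFun_apply_real,
    ← charFun_apply_real, charFun_gaussianReal, charFun_gaussianReal, ← Complex.exp_add]
  congr 1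
  have : (‖t‖ : ℂ) ^ 2 = t.re ^ 2 + t.im ^ 2 := by
    rw [← Complex.ofReal_pow, Complex.sq_norm, Complex.normSq_apply]
    push_cast
    ring
  rw [this]
  push_cast
  ring

lemma lintegral_gaussianReal_add (a : ℝ) {f : ℝ → ℝ≥0∞} (hf : Measurable f) :
    ∫⁻ x, f (x + a) ∂gaussianReal 0 1 =
      ∫⁻ x, f x * ENNReal.ofReal (Real.exp (a * x - a ^ 2 / 2)) ∂gaussianReal 0 1 := by
  have h1 : ∫⁻ x, f (x + a) ∂gaussianReal 0 1 = ∫⁻ x, f x ∂gaussianReal a 1 := by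
    rw [← lintegral_map hf (by fun_prop), gaussianReal_map_add_const, zero_add]
  rw [h1, gaussianReal_of_var_ne_zero _ one_ne_zero, gaussianReal_of_var_ne_zero _ one_ne_zero,
    lintegral_withDensity_eq_lintegral_mul _ (by fun_prop) hf,
    lintegral_withDensity_eq_lintegral_mul _ (by fun_prop) (by fun_prop)]
  refine lintegral_congr fun x => ?_
  simp only [Pi.mul_apply, gaussianPDF_def]
  rw [mul_comm (f x), ← mul_assoc, ← ENNReal.ofReal_mul (gaussianPDFReal_nonneg _ _ _)]
  congr 2
  rw [gaussianPDFReal, gaussianPDFReal, mul_assoc (Real.sqrt _)⁻¹, ← Real.exp_add]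
  congr 2
  simp
  ring

lemma lintegral_stdGaussian_add (s : ℂ) {f : ℂ → ℝ≥0∞} (hf : Measurable f) :
    ∫⁻ w, f (w + s) ∂stdGaussian ℂ =
      ∫⁻ w, f w * ENNReal.ofReal (Real.exp (inner ℝ s w - ‖s‖ ^ 2 / 2)) ∂stdGaussian ℂ := by
  have hm : Measurable (fun p : ℝ × ℝ => (⟨p.1, p.2⟩ : ℂ)) :=
    Complex.measurableEquivRealProd.symm.measurable
  rw [stdGaussian_complex_eq_map_prod, lintegral_map (by fun_prop) hm,
    lintegral_map (by fun_prop) hm, lintegral_prod _ (by fun_prop),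
    lintegral_prod _ (by fun_prop)]
  have h1 (x : ℝ) : ∫⁻ y, f ((⟨x, y⟩ : ℂ) + s) ∂gaussianReal 0 1 =
      ∫⁻ y, f ⟨x + s.re, y⟩ * ENNReal.ofReal (Real.exp (s.im * y - s.im ^ 2 / 2))
        ∂gaussianReal 0 1 := by
    rw [← lintegral_gaussianReal_add s.im (f := fun y => f ⟨x + s.re, y⟩)
      (hf.comp (hm.comp (measurable_prodMk_left (x := x + s.re))))]
    rfl
  have h2 : Measurable (fun x : ℝ => ∫⁻ y, f ⟨x, y⟩ *
      ENNReal.ofReal (Real.exp (s.im * y - s.im ^ 2 / 2)) ∂gaussianReal 0 1) :=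
    Measurable.lintegral_prod_right' (f := fun p : ℝ × ℝ => f ⟨p.1, p.2⟩ *
      ENNReal.ofReal (Real.exp (s.im * p.2 - s.im ^ 2 / 2))) (by fun_prop)
  simp_rw [h1]
  rw [lintegral_gaussianReal_add s.re h2]
  refine lintegral_congr fun x => ?_
  rw [← lintegral_mul_const' _ _ (by simp)]
  refine lintegral_congr fun y => ?_
  rw [mul_assoc, ← ENNReal.ofReal_mul (Real.exp_nonneg _), ← Real.exp_add]
  congr 3
  rw [Complex.inner, Complex.sq_norm, Complex.normSq_apply]
  simp
  ring

lemma integral_stdGaussian_add (s : ℂ) {f : ℂ → ℝ} (hf : Measurable f) :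
    ∫ w, f (w + s) ∂stdGaussian ℂ =
      ∫ w, Real.exp (inner ℝ s w - ‖s‖ ^ 2 / 2) * f w ∂stdGaussian ℂ := by
  have h : (stdGaussian ℂ).map (fun w => w + s) = (stdGaussian ℂ).withDensity
      (fun w => ENNReal.ofReal (Real.exp (inner ℝ s w - ‖s‖ ^ 2 / 2))) := by
    ext A hA
    rw [← lintegral_indicator_one hA, lintegral_map (measurable_one.indicator hA) (by fun_prop),
      lintegral_stdGaussian_add s (measurable_one.indicator hA), ← lintegral_indicator_one hA,
      lintegral_withDensity_eq_lintegral_mul _ (by fun_prop) (measurable_one.indicator hA)]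
    simp_rw [mul_comm (Set.indicator A 1 _)]
    rfl
  rw [← integral_map (f := f) (φ := fun w => w + s) (by fun_prop) hf.aestronglyMeasurable, h,
    integral_withDensity_eq_integral_toReal_smul (by fun_prop) (by simp)]
  simp [ENNReal.toReal_ofReal (Real.exp_nonneg _)]

/-- The remainder of the exponential series, with a geometric gain. -/
lemma abs_exp_sub_sum_le {x q X : ℝ} (hq : 0 ≤ q) (hq1 : q ≤ 1) (hX : 0 ≤ X) (hx : |x| ≤ q * X)
    (n : ℕ) :
    |Real.exp x - ∑ m ∈ Finset.range n, x ^ m / (m.factorial : ℝ)| ≤ q ^ n * Real.exp X := by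
  have key (y : ℝ) : HasSum (fun m : ℕ => y ^ (m + n) / ((m + n).factorial : ℝ))
      (Real.exp y - ∑ m ∈ Finset.range n, y ^ m / (m.factorial : ℝ)) := by
    have := NormedSpace.expSeries_div_hasSum_exp (𝔸 := ℝ) y
    rw [← Real.exp_eq_exp_ℝ] at this
    exact (hasSum_nat_add_iff' n).mpr this
  have hb (m : ℕ) : ‖x ^ (m + n) / ((m + n).factorial : ℝ)‖ ≤
      q ^ n * (X ^ (m + n) / ((m + n).factorial : ℝ)) := by
    rw [norm_div, norm_pow, Real.norm_eq_abs, Real.norm_natCast, ← mul_div_assoc]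
    gcongr
    calc |x| ^ (m + n) ≤ (q * X) ^ (m + n) := by gcongr
      _ = q ^ m * q ^ n * X ^ (m + n) := by rw [mul_pow, pow_add q]
      _ ≤ 1 * q ^ n * X ^ (m + n) := by gcongr; exact pow_le_one₀ hq hq1
      _ = _ := by rw [one_mul]
  have h1 := (key X).mul_left (q ^ n)
  rw [← (key x).tsum_eq, ← Real.norm_eq_abs]
  refine (tsum_of_norm_bounded h1 hb).trans ?_
  gcongr
  have : 0 ≤ ∑ m ∈ Finset.range n, X ^ m / (m.factorial : ℝ) :=
    Finset.sum_nonneg fun m _ => by positivity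
  linarith

/-- If a bounded function has vanishing moments of order less than `k` in direction `s`, then its
Laplace transform at `s` is small. -/
lemma abs_integral_exp_inner_mul_le {C₀ : ℝ} (hC₀ : 0 < C₀)
    (hint : Integrable (fun z : ℂ => Real.exp (C₀ * ‖z‖ ^ 2)) (stdGaussian ℂ))
    {g : ℂ → ℝ} (hg : Measurable g) (hg1 : ∀ w, |g w| ≤ 1) (k : ℕ) (s : ℂ)
    (hmom : ∀ m < k, ∫ w, inner ℝ s w ^ m * g w ∂stdGaussian ℂ = 0)
    {κ : ℝ} (hκ : 0 ≤ κ) (hκ1 : κ ≤ C₀) (z : ℂ) (hs : ‖s‖ = κ * ‖z‖) :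
    |∫ w, Real.exp (inner ℝ s w) * g w ∂stdGaussian ℂ| ≤
      (κ / C₀) ^ k * Real.exp (C₀ * ‖z‖ ^ 2) * ∫ w, Real.exp (C₀ * ‖w‖ ^ 2) ∂stdGaussian ℂ := by
  have hb (w : ℂ) : |Real.exp (inner ℝ s w) -
      ∑ m ∈ Finset.range k, (inner ℝ s w) ^ m / (m.factorial : ℝ)| ≤
      (κ / C₀) ^ k * Real.exp (C₀ * (‖z‖ ^ 2 + ‖w‖ ^ 2)) := by
    apply abs_exp_sub_sum_le (by positivity) (by rw [div_le_one hC₀]; exact hκ1) (by positivity)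
    calc |inner ℝ s w| ≤ ‖s‖ * ‖w‖ := abs_real_inner_le_norm s w
      _ = κ * (‖z‖ * ‖w‖) := by rw [hs]; ring
      _ ≤ κ * (‖z‖ ^ 2 + ‖w‖ ^ 2) := by
        gcongr
        nlinarith [sq_nonneg (‖z‖ - ‖w‖), sq_nonneg ‖z‖, sq_nonneg ‖w‖]
      _ = κ / C₀ * (C₀ * (‖z‖ ^ 2 + ‖w‖ ^ 2)) := by field_simp
  have hmem (m : ℕ) : Integrable (fun w : ℂ => (inner ℝ s w) ^ m * g w) (stdGaussian ℂ) := by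
    have h1 : Integrable (fun w : ℂ => ‖w‖ ^ m) (stdGaussian ℂ) := by
      have := (IsGaussian.memLp_id (stdGaussian ℂ) m (by simp)).integrable_norm_pow'
      simpa using this
    refine (h1.const_mul (‖s‖ ^ m)).mono' (by fun_prop) (.of_forall fun w => ?_)
    rw [norm_mul, norm_pow, ← mul_pow]
    calc _ ≤ (‖s‖ * ‖w‖) ^ m * 1 := by
          gcongr
          · exact abs_real_inner_le_norm s w
          · exact hg1 w
      _ = _ := mul_one _
  have hR : Integrable (fun w : ℂ => (Real.exp (inner ℝ s w) -
      ∑ m ∈ Finset.range k, (inner ℝ s w) ^ m / (m.factorial : ℝ)) * g w) (stdGaussian ℂ) := by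
    refine (hint.const_mul ((κ / C₀) ^ k * Real.exp (C₀ * ‖z‖ ^ 2))).mono' (by fun_prop)
      (.of_forall fun w => ?_)
    rw [norm_mul]
    calc _ ≤ (κ / C₀) ^ k * Real.exp (C₀ * (‖z‖ ^ 2 + ‖w‖ ^ 2)) * 1 :=
          mul_le_mul (hb w) (hg1 w) (abs_nonneg _) (by positivity)
      _ = _ := by rw [mul_add, Real.exp_add]; ring
  have hsum : Integrable (fun w : ℂ => ∑ m ∈ Finset.range k,
      ((m.factorial : ℝ))⁻¹ * ((inner ℝ s w) ^ m * g w)) (stdGaussian ℂ) :=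
    integrable_finsetSum _ fun m _ => (hmem m).const_mul _
  have heq : ∫ w, Real.exp (inner ℝ s w) * g w ∂stdGaussian ℂ =
      ∫ w, (Real.exp (inner ℝ s w) -
        ∑ m ∈ Finset.range k, (inner ℝ s w) ^ m / (m.factorial : ℝ)) * g w ∂stdGaussian ℂ := by
    have h0 : ∫ w, ∑ m ∈ Finset.range k,
        ((m.factorial : ℝ))⁻¹ * ((inner ℝ s w) ^ m * g w) ∂stdGaussian ℂ = 0 := by
      rw [integral_finsetSum _ fun m _ => (hmem m).const_mul _]
      refine Finset.sum_eq_zero fun m hm => ?_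
      rw [integral_const_mul, hmom m (Finset.mem_range.mp hm), mul_zero]
    rw [← add_zero (∫ w, (Real.exp (inner ℝ s w) - _) * g w ∂_), ← h0, ← integral_add hR hsum]
    refine integral_congr_ae (.of_forall fun w => ?_)
    simp only [sub_mul, Finset.sum_mul]
    rw [sub_add_eq_add_sub, eq_sub_iff_add_eq]
    congr 1
    exact Finset.sum_congr rfl fun m _ => by ring
  rw [heq, ← integral_const_mul, ← Real.norm_eq_abs]
  refine norm_integral_le_of_norm_le (hint.const_mul _) (.of_forall fun w => ?_)
  rw [norm_mul]
  calc _ ≤ (κ / C₀) ^ k * Real.exp (C₀ * (‖z‖ ^ 2 + ‖w‖ ^ 2)) * 1 :=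
        mul_le_mul (hb w) (hg1 w) (abs_nonneg _) (by positivity)
    _ = _ := by rw [mul_add, Real.exp_add]; ring

/-- Correlation bound for a pair of correlated complex Gaussians: if `g'` is invariant under scaling
and its moments of order less than `k` vanish, then correlation decays like the `k`-th power. -/
lemma exists_abs_integral_correlated_le :
    ∃ M C₁ : ℝ, 1 ≤ M ∧ 1 ≤ C₁ ∧ ∀ (k : ℕ) (g g' : ℂ → ℝ), Measurable g → Measurable g' →
      (∀ z, |g z| ≤ 1) → (∀ z, |g' z| ≤ 1) → (∀ (a : ℝ) (z : ℂ), 0 < a → g' (a * z) = g' z) →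
      (∀ s : ℂ, ∀ m < k, ∫ w, inner ℝ s w ^ m * g' w ∂stdGaussian ℂ = 0) →
      ∀ r σ : ℝ, 0 < σ → r ^ 2 + σ ^ 2 = 1 →
        |∫ p : ℂ × ℂ, g p.1 * g' (r * p.1 + σ * p.2)
          ∂(stdGaussian ℂ).prod (stdGaussian ℂ)| ≤ M * (C₁ * |r|) ^ k := by
  obtain ⟨C₀, hC₀, hint⟩ := IsGaussian.exists_integrable_exp_sq (stdGaussian ℂ)
  set I := ∫ w, Real.exp (C₀ * ‖w‖ ^ 2) ∂stdGaussian ℂ with hI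
  have hI0 : 0 ≤ I := integral_nonneg fun _ => Real.exp_nonneg _
  refine ⟨max 1 (I * I), max 2 (2 / C₀), le_max_left _ _,
    (by norm_num : (1 : ℝ) ≤ 2).trans (le_max_left _ _), ?_⟩
  intro k g g' hg hg' hg1 hg1' hsc hmom r σ hσ hrσ
  have htriv : |∫ p : ℂ × ℂ, g p.1 * g' (r * p.1 + σ * p.2)
      ∂(stdGaussian ℂ).prod (stdGaussian ℂ)| ≤ 1 := by
    have := norm_integral_le_of_norm_le_const (μ := (stdGaussian ℂ).prod (stdGaussian ℂ))
      (f := fun p : ℂ × ℂ => g p.1 * g' (r * p.1 + σ * p.2)) (C := 1) (.of_forall fun p => by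
        rw [norm_mul]
        exact mul_le_one₀ (hg1 _) (abs_nonneg _) (hg1' _))
    simpa using this
  have hM : (1 : ℝ) ≤ max 1 (I * I) := le_max_left _ _
  by_cases hbig : 1 ≤ max 2 (2 / C₀) * |r|
  · exact htriv.trans (one_le_mul_of_one_le_of_one_le hM (one_le_pow₀ hbig))
  push Not at hbig
  have hr2 : 2 * |r| < 1 :=
    lt_of_le_of_lt (by gcongr; exact le_max_left _ _) hbig
  have hrC : 2 / C₀ * |r| < 1 :=
    lt_of_le_of_lt (by gcongr; exact le_max_right _ _) hbig
  have hσ2 : 1 / 2 ≤ σ := by nlinarith [sq_abs r, abs_nonneg r]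
  set κ := |r| / σ with hκ
  have hκ0 : 0 ≤ κ := by positivity
  have hκ2 : κ ≤ 2 * |r| := by
    rw [hκ, div_le_iff₀ hσ]
    nlinarith [abs_nonneg r]
  have hκC : κ / C₀ ≤ 2 / C₀ * |r| := by
    rw [div_mul_eq_mul_div]
    gcongr
  have hκ1 : κ ≤ C₀ := by
    rw [← div_le_one hC₀]
    linarith
  have hmeas : Measurable (fun p : ℂ × ℂ => g p.1 * g' (r * p.1 + σ * p.2)) := by fun_prop
  have hinti : Integrable (fun p : ℂ × ℂ => g p.1 * g' (r * p.1 + σ * p.2))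
      ((stdGaussian ℂ).prod (stdGaussian ℂ)) :=
    Integrable.of_bound hmeas.aestronglyMeasurable 1 (.of_forall fun p => by
        rw [norm_mul]
        exact mul_le_one₀ (hg1 _) (abs_nonneg _) (hg1' _))
  have hin (z : ℂ) : |∫ w, g z * g' (r * z + σ * w) ∂stdGaussian ℂ| ≤
      (κ / C₀) ^ k * I * Real.exp (C₀ * ‖z‖ ^ 2) := by
    have h1 (w : ℂ) : g' (r * z + σ * w) = g' (w + (r / σ : ℝ) * z) := by
      rw [← hsc σ (w + (r / σ : ℝ) * z) hσ]
      congr 1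
      have : (σ : ℂ) ≠ 0 := by exact_mod_cast hσ.ne'
      push_cast
      field_simp
      ring
    simp_rw [h1]
    rw [integral_const_mul, integral_stdGaussian_add _ hg', abs_mul]
    have hs : ‖((r / σ : ℝ) * z : ℂ)‖ = κ * ‖z‖ := by
      rw [norm_mul, Complex.norm_real, Real.norm_eq_abs, abs_div, abs_of_pos hσ]
    have h2 := abs_integral_exp_inner_mul_le hC₀ hint hg' hg1' k _ (hmom ((r / σ : ℝ) * z)) hκ0 hκ1
      z hs
    have h3 (w : ℂ) : Real.exp (inner ℝ ((r / σ : ℝ) * z) w - ‖((r / σ : ℝ) * z : ℂ)‖ ^ 2 / 2) *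
        g' w = Real.exp (- (‖((r / σ : ℝ) * z : ℂ)‖ ^ 2 / 2)) *
        (Real.exp (inner ℝ ((r / σ : ℝ) * z) w) * g' w) := by
      rw [← mul_assoc, ← Real.exp_add]
      congr 2
      ring
    simp_rw [h3]
    rw [integral_const_mul, abs_mul, abs_of_pos (Real.exp_pos _)]
    calc _ ≤ 1 * (1 * ((κ / C₀) ^ k * Real.exp (C₀ * ‖z‖ ^ 2) * I)) := by
          gcongr
          · exact hg1 z
          · exact Real.exp_le_one_iff.mpr (by simp; positivity)
      _ = _ := by ring
  rw [integral_prod _ hinti, ← Real.norm_eq_abs]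
  calc _ ≤ ∫ z, (κ / C₀) ^ k * I * Real.exp (C₀ * ‖z‖ ^ 2) ∂stdGaussian ℂ :=
        norm_integral_le_of_norm_le (hint.const_mul _) (.of_forall hin)
    _ = (I * I) * (κ / C₀) ^ k := by rw [integral_const_mul, ← hI]; ring
    _ ≤ _ := by
        gcongr
        · exact le_max_right _ _
        · exact hκC.trans (by gcongr; exact le_max_right _ _)

/-- The complex coordinate of `x` in the plane spanned by `a` and `b`. -/
noncomputable def planeCoord {E : Type*} [NormedAddCommGroup E] [InnerProductSpace ℝ E] (a b : E) :
    E →L[ℝ] ℂ :=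
  (innerSL ℝ a).smulRight (1 : ℂ) + (innerSL ℝ b).smulRight Complex.I

section

variable {E : Type*} [NormedAddCommGroup E] [InnerProductSpace ℝ E]

lemma planeCoord_apply (a b x : E) :
    planeCoord a b x = ⟨inner ℝ a x, inner ℝ b x⟩ := by
  apply Complex.ext <;> simp [planeCoord]

lemma charFunDual_stdGaussian_eq [FiniteDimensional ℝ E] [MeasurableSpace E] [BorelSpace E]
    (L : StrongDual ℝ E) (p : E) (h : ∀ x, L x = inner ℝ p x) :
    charFunDual (stdGaussian E) L = Complex.exp (- ‖p‖ ^ 2 / 2) := by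
  have : L = InnerProductSpace.toDual ℝ E p := by ext x; simp [h]
  rw [charFunDual_stdGaussian, this, LinearIsometryEquiv.norm_map]

/-- The joint law of the coordinates of a standard Gaussian vector in two planes, when the
coordinate systems are related by the correlation `r`. -/
lemma map_planeCoord_prod_stdGaussian [FiniteDimensional ℝ E] [MeasurableSpace E] [BorelSpace E]
    {a b a' b' : E} {r σ : ℝ} (hrσ : r ^ 2 + σ ^ 2 = 1)
    (haa : inner ℝ a a = (1 : ℝ)) (hbb : inner ℝ b b = (1 : ℝ))
    (haa' : inner ℝ a' a' = (1 : ℝ)) (hbb' : inner ℝ b' b' = (1 : ℝ))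
    (hab : inner ℝ a b = (0 : ℝ)) (hab' : inner ℝ a' b' = (0 : ℝ))
    (h12 : inner ℝ a b' = (0 : ℝ)) (h21 : inner ℝ a' b = (0 : ℝ))
    (h11 : inner ℝ a a' = r) (h22 : inner ℝ b b' = r) :
    (stdGaussian E).map (fun x => (planeCoord a b x, planeCoord a' b' x)) =
      ((stdGaussian ℂ).prod (stdGaussian ℂ)).map
        (fun p : ℂ × ℂ => (p.1, (r : ℂ) * p.1 + (σ : ℂ) * p.2)) := by
  set T : E →L[ℝ] ℂ × ℂ := (planeCoord a b).prod (planeCoord a' b')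
  set S : ℂ × ℂ →L[ℝ] ℂ × ℂ := (ContinuousLinearMap.fst ℝ ℂ ℂ).prod
    (r • ContinuousLinearMap.fst ℝ ℂ ℂ + σ • ContinuousLinearMap.snd ℝ ℂ ℂ)
  have hT : (fun x => (planeCoord a b x, planeCoord a' b' x)) = T := rfl
  have hS : (fun p : ℂ × ℂ => (p.1, (r : ℂ) * p.1 + (σ : ℂ) * p.2)) = S := by
    ext p <;> simp [S]
  rw [hT, hS]
  have := Measure.isProbabilityMeasure_map (μ := stdGaussian E) (f := T) (by fun_prop)
  have := Measure.isProbabilityMeasure_map (μ := (stdGaussian ℂ).prod (stdGaussian ℂ)) (f := S)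
    (by fun_prop)
  apply Measure.ext_of_charFunDual
  ext L
  rw [charFunDual_map, charFunDual_map, charFunDual_prod]
  obtain ⟨p, hp⟩ : ∃ p : ℂ, ∀ z, L (z, 0) = inner ℝ p z :=
    ⟨(InnerProductSpace.toDual ℝ ℂ).symm (L ∘SL ContinuousLinearMap.inl ℝ ℂ ℂ), fun z => by
      rw [InnerProductSpace.toDual_symm_apply]; simp⟩
  obtain ⟨q, hq⟩ : ∃ q : ℂ, ∀ z, L (0, z) = inner ℝ q z :=
    ⟨(InnerProductSpace.toDual ℝ ℂ).symm (L ∘SL ContinuousLinearMap.inr ℝ ℂ ℂ), fun z => by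
      rw [InnerProductSpace.toDual_symm_apply]; simp⟩
  have hL (z w : ℂ) : L (z, w) = inner ℝ p z + inner ℝ q w := by
    rw [← hp, ← hq, ← map_add]; simp
  rw [charFunDual_stdGaussian_eq _ (p.re • a + p.im • b + q.re • a' + q.im • b') ?_,
    charFunDual_stdGaussian_eq _ (p + (r : ℂ) * q) ?_,
    charFunDual_stdGaussian_eq _ ((σ : ℂ) * q) ?_, ← Complex.exp_add]
  · congr 1
    have hba : inner ℝ b a = (0 : ℝ) := by rw [real_inner_comm]; exact hab
    have hba' : inner ℝ b' a' = (0 : ℝ) := by rw [real_inner_comm]; exact hab'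
    have h21' : inner ℝ b a' = (0 : ℝ) := by rw [real_inner_comm]; exact h21
    have h12' : inner ℝ b' a = (0 : ℝ) := by rw [real_inner_comm]; exact h12
    have h11' : inner ℝ a' a = r := by rw [real_inner_comm]; exact h11
    have h22' : inner ℝ b' b = r := by rw [real_inner_comm]; exact h22
    have hn : ‖p.re • a + p.im • b + q.re • a' + q.im • b'‖ ^ 2 =
        ‖p + (r : ℂ) * q‖ ^ 2 + ‖(σ : ℂ) * q‖ ^ 2 := by
      rw [← real_inner_self_eq_norm_sq, Complex.sq_norm, Complex.sq_norm, Complex.normSq_apply,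
        Complex.normSq_apply]
      simp only [inner_add_left, inner_add_right, real_inner_smul_left, real_inner_smul_right,
        haa, hbb, haa', hbb', hab, hab', h12, h21, h11, h22, hba, hba', h21', h12', h11', h22']
      simp
      linear_combination (-q.re ^ 2 - q.im ^ 2) * hrσ
    rw [← Complex.ofReal_pow, hn]
    push_cast
    ring
  · intro z
    simp [S, hL, Complex.inner]
    ring
  · intro z
    simp only [S, ContinuousLinearMap.comp_apply, ContinuousLinearMap.inl_apply,
      ContinuousLinearMap.prod_apply, ContinuousLinearMap.coe_fst', add_apply,
      smul_apply, ContinuousLinearMap.coe_snd', hL, Complex.inner]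
    simp
    ring
  · intro x
    simp only [T, ContinuousLinearMap.comp_apply, ContinuousLinearMap.prod_apply, hL,
      planeCoord_apply, inner_add_left, real_inner_smul_left, Complex.inner]
    simp
    ring

end

/-! ### Sectors of the plane -/

lemma exists_first_argmax {K : ℕ} [NeZero K] (s : Fin K → ℝ) :
    ∃ i, (∀ j, s j ≤ s i) ∧ ∀ j, j < i → s j < s i := by
  obtain ⟨i₀, hi₀⟩ := Finite.exists_max s
  obtain ⟨i, hi, hmin⟩ := WellFounded.has_min (wellFounded_lt (α := Fin K))
    {i | ∀ j, s j ≤ s i} ⟨i₀, hi₀⟩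
  refine ⟨i, hi, fun j hj => lt_of_not_ge fun h => hmin j (fun l => (hi l).trans h) hj⟩

lemma first_argmax_unique {K : ℕ} {s : Fin K → ℝ} {i i' : Fin K}
    (h : (∀ j, s j ≤ s i) ∧ ∀ j, j < i → s j < s i)
    (h' : (∀ j, s j ≤ s i') ∧ ∀ j, j < i' → s j < s i') : i = i' := by
  rcases lt_trichotomy i i' with hlt | heq | hlt
  · exact absurd (h'.2 _ hlt) (not_lt.mpr (h.1 _))
  · exact heq
  · exact absurd (h.2 _ hlt) (not_lt.mpr (h'.1 _))

/-- The primitive `K`-th root of unity `exp (2πi / K)`. -/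
noncomputable def unitRoot (K : ℕ) : ℂ := Complex.exp (2 * Real.pi * Complex.I / K)

section sector

variable {K : ℕ} [NeZero K]

lemma isPrimitiveRoot_unitRoot : IsPrimitiveRoot (unitRoot K) K :=
  Complex.isPrimitiveRoot_exp K (NeZero.ne K)

lemma norm_unitRoot : ‖unitRoot K‖ = 1 :=
  isPrimitiveRoot_unitRoot.norm'_eq_one (NeZero.ne K)

lemma unitRoot_pow_val_add_one (i : Fin K) :
    unitRoot K ^ ((i + 1 : Fin K) : ℕ) = unitRoot K * unitRoot K ^ (i : ℕ) := by
  rw [Fin.val_add, Fin.val_one', Nat.add_mod_mod, ← pow_succ']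
  conv_rhs => rw [← Nat.div_add_mod (i + 1 : ℕ) K, pow_add, pow_mul,
    isPrimitiveRoot_unitRoot.pow_eq_one, one_pow, one_mul]

/-- The index of the sector containing `z`: the smallest `i` maximizing the inner product of `z`
with the `i`-th power of the root of unity. -/
noncomputable def sectorIndex (K : ℕ) [NeZero K] (z : ℂ) : Fin K :=
  (exists_first_argmax fun i : Fin K => inner ℝ (unitRoot K ^ (i : ℕ)) z).choose

lemma sectorIndex_spec (z : ℂ) :
    (∀ j : Fin K, inner ℝ (unitRoot K ^ (j : ℕ)) z ≤
      (inner ℝ (unitRoot K ^ (sectorIndex K z : ℕ)) z : ℝ)) ∧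
    ∀ j : Fin K, j < sectorIndex K z → inner ℝ (unitRoot K ^ (j : ℕ)) z <
      (inner ℝ (unitRoot K ^ (sectorIndex K z : ℕ)) z : ℝ) :=
  (exists_first_argmax fun i : Fin K => inner ℝ (unitRoot K ^ (i : ℕ)) z).choose_spec

lemma sectorIndex_eq {z : ℂ} {i : Fin K}
    (h : (∀ j : Fin K, inner ℝ (unitRoot K ^ (j : ℕ)) z ≤ (inner ℝ (unitRoot K ^ (i : ℕ)) z : ℝ)) ∧
      ∀ j : Fin K, j < i →
        inner ℝ (unitRoot K ^ (j : ℕ)) z < (inner ℝ (unitRoot K ^ (i : ℕ)) z : ℝ)) :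
    sectorIndex K z = i :=
  first_argmax_unique (s := fun i : Fin K => inner ℝ (unitRoot K ^ (i : ℕ)) z)
    (sectorIndex_spec z) h

lemma measurable_sectorIndex : Measurable (sectorIndex K) := by
  refine measurable_to_countable' fun i => ?_
  have : sectorIndex K ⁻¹' {i} = (⋂ j : Fin K, {z | inner ℝ (unitRoot K ^ (j : ℕ)) z ≤
      (inner ℝ (unitRoot K ^ (i : ℕ)) z : ℝ)}) ∩
      ⋂ j : Fin K, ⋂ _ : j < i, {z | inner ℝ (unitRoot K ^ (j : ℕ)) z <
        (inner ℝ (unitRoot K ^ (i : ℕ)) z : ℝ)} := by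
    ext z
    simp only [Set.mem_preimage, Set.mem_singleton_iff, Set.mem_inter_iff, Set.mem_iInter,
      Set.mem_ofPred_eq]
    exact ⟨fun h => h ▸ sectorIndex_spec z, sectorIndex_eq⟩
  rw [this]
  refine (MeasurableSet.iInter fun j => measurableSet_le (by fun_prop) (by fun_prop)).inter
    (MeasurableSet.iInter fun j => MeasurableSet.iInter fun _ =>
      measurableSet_lt (by fun_prop) (by fun_prop))

lemma sectorIndex_smul (a : ℝ) (z : ℂ) (ha : 0 < a) : sectorIndex K (a * z) = sectorIndex K z := by
  apply sectorIndex_eq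
  have h (j : Fin K) : (inner ℝ (unitRoot K ^ (j : ℕ)) ((a : ℂ) * z) : ℝ) =
      a * inner ℝ (unitRoot K ^ (j : ℕ)) z := by
    rw [← Complex.real_smul, real_inner_smul_right]
  simp_rw [h]
  exact ⟨fun j => mul_le_mul_of_nonneg_left ((sectorIndex_spec z).1 j) ha.le,
    fun j hj => mul_lt_mul_of_pos_left ((sectorIndex_spec z).2 j hj) ha⟩

lemma ae_stdGaussian_inner_ne_zero {p : ℂ} (hp : p ≠ 0) :
    ∀ᵐ z ∂stdGaussian ℂ, (inner ℝ p z : ℝ) ≠ 0 := by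
  have h := IsGaussian.map_eq_gaussianReal (μ := stdGaussian ℂ) (innerSL ℝ p)
  rw [variance_dual_stdGaussian, innerSL_apply_norm] at h
  have hv : (‖p‖ ^ 2).toNNReal ≠ 0 := by
    simpa using hp
  have h0 : (stdGaussian ℂ).map (innerSL ℝ p) {0} = 0 := by
    rw [h]
    have := nullSingletonClass_gaussianReal
      (μ := ∫ x, innerSL ℝ p x ∂stdGaussian ℂ) hv
    exact measure_singleton 0
  rw [Measure.map_apply (by fun_prop) (measurableSet_singleton 0)] at h0
  rw [ae_iff]
  convert h0 using 2
  ext z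
  simp

lemma ae_sectorIndex_unitRoot_mul :
    ∀ᵐ z ∂stdGaussian ℂ, sectorIndex K (unitRoot K * z) = sectorIndex K z + 1 := by
  have h : ∀ᵐ z ∂stdGaussian ℂ, ∀ i j : Fin K, i ≠ j →
      (inner ℝ (unitRoot K ^ (i : ℕ) - unitRoot K ^ (j : ℕ)) z : ℝ) ≠ 0 := by
    simp_rw [ae_all_iff]
    intro i j hij
    refine ae_stdGaussian_inner_ne_zero fun h => hij (Fin.ext ?_)
    exact isPrimitiveRoot_unitRoot.pow_inj i.2 j.2 (sub_eq_zero.mp h)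
  filter_upwards [h] with z hz
  have hrot (j : Fin K) : (inner ℝ (unitRoot K ^ ((j + 1 : Fin K) : ℕ)) (unitRoot K * z) : ℝ) =
      inner ℝ (unitRoot K ^ (j : ℕ)) z := by
    rw [unitRoot_pow_val_add_one, Complex.inner, Complex.inner, map_mul]
    have : unitRoot K * (starRingEnd ℂ) (unitRoot K) = 1 := by
      rw [Complex.mul_conj, Complex.normSq_eq_norm_sq, norm_unitRoot]
      simp
    rw [mul_mul_mul_comm, this, one_mul]
  have hlt (j : Fin K) (hj : j ≠ sectorIndex K z) : (inner ℝ (unitRoot K ^ (j : ℕ)) z : ℝ) <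
      inner ℝ (unitRoot K ^ (sectorIndex K z : ℕ)) z := by
    refine lt_of_le_of_ne ((sectorIndex_spec z).1 j) fun h => hz j _ hj ?_
    rw [inner_sub_left, h, sub_self]
  apply sectorIndex_eq
  rw [hrot]
  constructor
  · intro j
    have := hrot (j - 1)
    rw [sub_add_cancel] at this
    rw [this]
    exact (sectorIndex_spec z).1 _
  · intro j hj
    have := hrot (j - 1)
    rw [sub_add_cancel] at this
    rw [this]
    refine hlt _ fun h => hj.ne ?_
    rw [← h, sub_add_cancel]

lemma integral_stdGaussian_unitRoot_mul (f : ℂ → ℂ) :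
    ∫ z, f (unitRoot K * z) ∂stdGaussian ℂ = ∫ z, f z ∂stdGaussian ℂ := by
  set c : Circle := ⟨unitRoot K, by simp [Submonoid.unitSphere, norm_unitRoot]⟩
  have h := stdGaussian_map (rotation c)
  conv_rhs => rw [← h]
  have he : MeasurableEmbedding (rotation c) :=
    (rotation c).toHomeomorph.measurableEmbedding
  rw [he.integral_map]
  rfl

/-- Mixed moments of `ω^{k · sector}` of low degree vanish by rotational symmetry. -/
lemma integral_sectorIndex_pow_mul_eq_zero {k a b : ℕ} (hk : 2 * k ≤ K) (hab : a + b < k) :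
    ∫ z, (unitRoot K ^ (sectorIndex K z : ℕ)) ^ k * (z ^ a * (starRingEnd ℂ z) ^ b)
      ∂stdGaussian ℂ = 0 := by
  set F := ∫ z, (unitRoot K ^ (sectorIndex K z : ℕ)) ^ k * (z ^ a * (starRingEnd ℂ z) ^ b)
      ∂stdGaussian ℂ with hF
  have hne : unitRoot K ^ k * unitRoot K ^ a * (starRingEnd ℂ (unitRoot K)) ^ b ≠ 1 := by
    intro h
    have h1 : unitRoot K ^ (k + a) = unitRoot K ^ b := by
      have h2 : (starRingEnd ℂ (unitRoot K)) ^ b * unitRoot K ^ b = 1 := by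
        rw [← mul_pow, mul_comm, Complex.mul_conj, Complex.normSq_eq_norm_sq, norm_unitRoot]
        simp
      calc _ = unitRoot K ^ k * unitRoot K ^ a * ((starRingEnd ℂ (unitRoot K)) ^ b *
            unitRoot K ^ b) := by rw [h2, mul_one, pow_add]
        _ = _ := by rw [← mul_assoc, h, one_mul]
    have := isPrimitiveRoot_unitRoot.pow_inj (by omega) (by omega) h1
    omega
  have hrot : F = unitRoot K ^ k * unitRoot K ^ a * (starRingEnd ℂ (unitRoot K)) ^ b * F := by
    conv_lhs => rw [hF, ← integral_stdGaussian_unitRoot_mul (K := K)]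
    rw [hF, ← integral_const_mul]
    refine integral_congr_ae ?_
    filter_upwards [ae_sectorIndex_unitRoot_mul (K := K)] with z hz
    rw [hz, unitRoot_pow_val_add_one, map_mul]
    ring
  have : (1 - unitRoot K ^ k * unitRoot K ^ a * (starRingEnd ℂ (unitRoot K)) ^ b) * F = 0 := by
    rw [sub_mul, ← hrot, one_mul, sub_self]
  exact (mul_eq_zero.mp this).resolve_left (sub_ne_zero.mpr hne.symm)

/-! ### The cosine kernel -/

/-- The kernel `cos (2πk (i - j) / K)`. -/
noncomputable def cosKernel (K k : ℕ) (i j : Fin K) : ℝ :=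
  ((unitRoot K ^ (i : ℕ)) ^ k * starRingEnd ℂ ((unitRoot K ^ (j : ℕ)) ^ k)).re

lemma norm_unitRoot_pow_mul_conj (k : ℕ) (i j : Fin K) :
    ‖(unitRoot K ^ (i : ℕ)) ^ k * starRingEnd ℂ ((unitRoot K ^ (j : ℕ)) ^ k)‖ = 1 := by
  simp [norm_unitRoot]

lemma abs_cosKernel_le_one (k : ℕ) (i j : Fin K) : |cosKernel K k i j| ≤ 1 :=
  (Complex.abs_re_le_norm _).trans (norm_unitRoot_pow_mul_conj k i j).le

lemma cosKernel_self (k : ℕ) (i : Fin K) : cosKernel K k i i = 1 := by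
  rw [cosKernel, Complex.mul_conj, Complex.normSq_eq_norm_sq]
  simp [norm_unitRoot]

/-- A nontrivial root of unity of order dividing `K` has real part bounded away from `1`. -/
lemma two_div_sq_le_one_sub_re {η : ℂ} (h1 : ‖η‖ = 1) (hK : η ^ K = 1) (hne : η ≠ 1) :
    2 / (K : ℝ) ^ 2 ≤ 1 - η.re := by
  have hKpos : (0 : ℝ) < K := by exact_mod_cast NeZero.pos K
  have hgeom : ∑ m ∈ Finset.range K, η ^ m = 0 := by
    have := mul_geom_sum η K
    rw [hK, sub_self] at this
    exact (mul_eq_zero.mp this).resolve_left (sub_ne_zero.mpr hne)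
  have hpow (m : ℕ) : ‖1 - η ^ m‖ ≤ m * ‖1 - η‖ := by
    rw [← norm_neg, neg_sub, ← mul_geom_sum, norm_mul, mul_comm, ← norm_neg (η - 1), neg_sub]
    gcongr
    refine (norm_sum_le _ _).trans ?_
    simp [h1]
  have hsum : (K : ℝ) ≤ (K : ℝ) ^ 2 / 2 * ‖1 - η‖ := by
    calc (K : ℝ) = ‖∑ m ∈ Finset.range K, (1 - η ^ m)‖ := by
          rw [Finset.sum_sub_distrib, hgeom]; simp
      _ ≤ ∑ m ∈ Finset.range K, (m : ℝ) * ‖1 - η‖ :=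
          (norm_sum_le _ _).trans (Finset.sum_le_sum fun m _ => hpow m)
      _ = (∑ m ∈ Finset.range K, (m : ℝ)) * ‖1 - η‖ := by rw [Finset.sum_mul]
      _ ≤ _ := by
          gcongr
          have := Finset.sum_range_id_mul_two K
          have h2 : (∑ m ∈ Finset.range K, (m : ℝ)) * 2 ≤ K * K := by
            have : (∑ m ∈ Finset.range K, m) * 2 ≤ K * K := by
              rw [this]; exact Nat.mul_le_mul_left _ (Nat.sub_le _ _)
            have h3 : ((∑ m ∈ Finset.range K, m : ℕ) : ℝ) * 2 ≤ K * K := by exact_mod_cast this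
            rwa [Nat.cast_sum] at h3
          nlinarith
  have hlow : 2 / (K : ℝ) ≤ ‖1 - η‖ := by
    rw [div_le_iff₀ hKpos]
    nlinarith
  have hsq : ‖1 - η‖ ^ 2 = 2 * (1 - η.re) := by
    rw [Complex.sq_norm, Complex.normSq_apply]
    have : η.re * η.re + η.im * η.im = 1 := by
      rw [← Complex.normSq_apply, Complex.normSq_eq_norm_sq, h1, one_pow]
    simp
    nlinarith
  have : (2 / (K : ℝ)) ^ 2 ≤ 2 * (1 - η.re) := by
    rw [← hsq]; gcongr
  rw [div_pow] at this
  have h4 : (2 : ℝ) ^ 2 / (K : ℝ) ^ 2 = 2 * (2 / (K : ℝ) ^ 2) := by ring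
  linarith

lemma two_div_sq_le_one_sub_cosKernel {k : ℕ} (hk : k.Coprime K) {i j : Fin K} (hij : i ≠ j) :
    2 / (K : ℝ) ^ 2 ≤ 1 - cosKernel K k i j := by
  have hprim : IsPrimitiveRoot (unitRoot K ^ k) K :=
    isPrimitiveRoot_unitRoot.pow_of_coprime k hk
  refine two_div_sq_le_one_sub_re (norm_unitRoot_pow_mul_conj k i j) ?_ ?_
  · rw [mul_pow, ← map_pow]
    have h (l : Fin K) : ((unitRoot K ^ (l : ℕ)) ^ k) ^ K = 1 := by
      rw [show ((unitRoot K ^ (l : ℕ)) ^ k) ^ K = (unitRoot K ^ K) ^ (l * k : ℕ) by ring,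
        isPrimitiveRoot_unitRoot.pow_eq_one, one_pow]
    rw [h, h]
    simp
  · intro h
    apply hij
    have h2 : starRingEnd ℂ ((unitRoot K ^ (j : ℕ)) ^ k) * (unitRoot K ^ (j : ℕ)) ^ k = 1 := by
      rw [mul_comm, Complex.mul_conj, Complex.normSq_eq_norm_sq]
      simp [norm_unitRoot]
    have h3 : (unitRoot K ^ (i : ℕ)) ^ k = (unitRoot K ^ (j : ℕ)) ^ k := by
      calc _ = (unitRoot K ^ (i : ℕ)) ^ k * (starRingEnd ℂ ((unitRoot K ^ (j : ℕ)) ^ k) *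
            (unitRoot K ^ (j : ℕ)) ^ k) := by rw [h2, mul_one]
        _ = _ := by rw [← mul_assoc, h, one_mul]
    rw [← pow_mul, ← pow_mul, mul_comm, mul_comm (j : ℕ), pow_mul, pow_mul] at h3
    exact Fin.ext (hprim.pow_inj i.2 j.2 h3)

lemma sum_conj_unitRoot_pow {k : ℕ} (h : unitRoot K ^ k ≠ 1) :
    ∑ j : Fin K, starRingEnd ℂ ((unitRoot K ^ (j : ℕ)) ^ k) = 0 := by
  rw [← map_sum]
  have h1 : ∑ j : Fin K, (unitRoot K ^ (j : ℕ)) ^ k = ∑ j ∈ Finset.range K,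
      (unitRoot K ^ k) ^ j := by
    rw [Finset.sum_range]
    exact Finset.sum_congr rfl fun j _ => by rw [← pow_mul, ← pow_mul, mul_comm]
  have h2 := mul_geom_sum (unitRoot K ^ k) K
  rw [← pow_mul, mul_comm k, pow_mul, isPrimitiveRoot_unitRoot.pow_eq_one, one_pow, sub_self] at h2
  rw [h1, (mul_eq_zero.mp h2).resolve_left (sub_ne_zero.mpr h), map_zero]

lemma sum_cosKernel {k : ℕ} (hk : k.Coprime K) (hK : 1 < K) (i : Fin K) :
    ∑ j, cosKernel K k i j = 0 := by
  have hprim : IsPrimitiveRoot (unitRoot K ^ k) K :=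
    isPrimitiveRoot_unitRoot.pow_of_coprime k hk
  simp_rw [cosKernel]
  rw [← Complex.re_sum, ← Finset.mul_sum, sum_conj_unitRoot_pow (hprim.ne_one hK), mul_zero,
    Complex.zero_re]

lemma le_sum_cosKernel_sq (k : ℕ) (i : Fin K) :
    (K : ℝ) / 2 ≤ ∑ j, cosKernel K k i j ^ 2 := by
  have hsq (j : Fin K) : cosKernel K k i j ^ 2 = 1 / 2 + 1 / 2 *
      ((unitRoot K ^ (i : ℕ)) ^ (2 * k) * starRingEnd ℂ ((unitRoot K ^ (j : ℕ)) ^ (2 * k))).re := by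
    have h1 := norm_unitRoot_pow_mul_conj k i j
    have h2 : (unitRoot K ^ (i : ℕ)) ^ (2 * k) * starRingEnd ℂ ((unitRoot K ^ (j : ℕ)) ^ (2 * k)) =
        ((unitRoot K ^ (i : ℕ)) ^ k * starRingEnd ℂ ((unitRoot K ^ (j : ℕ)) ^ k)) ^ 2 := by
      rw [mul_pow, ← map_pow, ← pow_mul _ k 2, ← pow_mul _ k 2, mul_comm k]
    rw [h2, cosKernel]
    generalize (unitRoot K ^ (i : ℕ)) ^ k * starRingEnd ℂ ((unitRoot K ^ (j : ℕ)) ^ k) = η at h1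
    have h3 : η.re * η.re + η.im * η.im = 1 := by
      rw [← Complex.normSq_apply, Complex.normSq_eq_norm_sq, h1, one_pow]
    rw [sq η, Complex.mul_re]
    nlinarith
  simp_rw [hsq]
  rw [Finset.sum_add_distrib, ← Finset.mul_sum, ← Complex.re_sum, ← Finset.mul_sum]
  by_cases h : unitRoot K ^ (2 * k) = 1
  · have h4 (l : Fin K) : (unitRoot K ^ (l : ℕ)) ^ (2 * k) = 1 := by
      rw [← pow_mul, mul_comm, pow_mul, h, one_pow]
    simp [h4]
    have : (0 : ℝ) ≤ K := by positivity
    linarith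
  · rw [sum_conj_unitRoot_pow h]
    simp
    linarith

/-- The cosine kernel of the sector has vanishing moments of order less than `k`. -/
lemma integral_inner_pow_mul_cosKernel {k m : ℕ} (hk : 2 * k ≤ K) (hm : m < k) (s : ℂ)
    (j : Fin K) :
    ∫ w, inner ℝ s w ^ m * cosKernel K k (sectorIndex K w) j ∂stdGaussian ℂ = 0 := by
  have hmeas : Measurable (fun z => (unitRoot K ^ (sectorIndex K z : ℕ)) ^ k) :=
    (measurable_of_countable (fun i : Fin K => (unitRoot K ^ (i : ℕ)) ^ k)).comp
      measurable_sectorIndex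
  have hint (a b : ℕ) : Integrable (fun z : ℂ => (unitRoot K ^ (sectorIndex K z : ℕ)) ^ k *
      (z ^ a * (starRingEnd ℂ z) ^ b)) (stdGaussian ℂ) := by
    have h1 : Integrable (fun w : ℂ => ‖w‖ ^ (a + b)) (stdGaussian ℂ) := by
      have := (IsGaussian.memLp_id (stdGaussian ℂ) ((a + b : ℕ) : ℝ≥0∞)
        (by simp)).integrable_norm_pow'
      simpa using this
    refine h1.mono' (Measurable.aestronglyMeasurable (hmeas.mul (by fun_prop)))
      (.of_forall fun w => ?_)
    simp [norm_unitRoot, pow_add]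
  set c := starRingEnd ℂ ((unitRoot K ^ (j : ℕ)) ^ k)
  have hexp (w : ℂ) : inner ℝ s w ^ m * cosKernel K k (sectorIndex K w) j =
      (∑ a ∈ Finset.range (m + 1), (c * (2⁻¹ : ℂ) ^ m * (m.choose a) * (starRingEnd ℂ s) ^ a *
        s ^ (m - a)) * ((unitRoot K ^ (sectorIndex K w : ℕ)) ^ k *
        (w ^ a * (starRingEnd ℂ w) ^ (m - a)))).re := by
    have h1 : ((inner ℝ s w : ℝ) : ℂ) = 2⁻¹ * (starRingEnd ℂ s * w + s * starRingEnd ℂ w) := by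
      rw [Complex.inner]
      apply Complex.ext <;> simp <;> ring
    have h2 : inner ℝ s w ^ m * cosKernel K k (sectorIndex K w) j =
        (((inner ℝ s w : ℝ) : ℂ) ^ m * ((unitRoot K ^ (sectorIndex K w : ℕ)) ^ k * c)).re := by
      rw [← Complex.ofReal_pow, Complex.re_ofReal_mul, cosKernel]
    rw [h2, h1, mul_pow, add_pow, Finset.mul_sum, Finset.sum_mul]
    congr 1
    refine Finset.sum_congr rfl fun a _ => ?_
    rw [mul_pow, mul_pow]
    ring
  simp_rw [hexp]
  have hint' (a : ℕ) : Integrable (fun w : ℂ => (c * (2⁻¹ : ℂ) ^ m * (m.choose a) *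
      (starRingEnd ℂ s) ^ a * s ^ (m - a)) * ((unitRoot K ^ (sectorIndex K w : ℕ)) ^ k *
        (w ^ a * (starRingEnd ℂ w) ^ (m - a)))) (stdGaussian ℂ) := (hint a (m - a)).const_mul _
  have hre := integral_re (𝕜 := ℂ) (integrable_finsetSum (Finset.range (m + 1)) fun a _ => hint' a)
  simp only [RCLike.re_to_complex] at hre
  rw [hre, integral_finsetSum _ fun a _ => hint' a, Finset.sum_eq_zero, Complex.zero_re]
  intro a ha
  have ha' : a ≤ m := Nat.lt_succ_iff.mp (Finset.mem_range.mp ha)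
  rw [integral_const_mul, integral_sectorIndex_pow_mul_eq_zero hk (by omega), mul_zero]

end sector

/-- A frequency coprime to `K` which is at most `K / 2` and comparable to `K`. -/
lemma exists_coprime_frequency {K : ℕ} (hK : 2 ≤ K) :
    ∃ k : ℕ, 0 < k ∧ k.Coprime K ∧ 2 * k ≤ K ∧ K ≤ 6 * k := by
  rcases Nat.even_or_odd' K with ⟨m, hm | hm⟩
  · rcases Nat.even_or_odd' m with ⟨l, hl | hl⟩
    · refine ⟨2 * l - 1, by omega, ?_, by omega, by omega⟩
      have h : (2 * l - 1).Coprime 2 := by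
        rw [Nat.coprime_two_right]
        exact ⟨l - 1, by omega⟩
      have h' : (2 * l - 1).Coprime (2 * l) := by
        have := Nat.coprime_self_add_right (m := 2 * l - 1) (n := 1)
        rw [show 2 * l - 1 + 1 = 2 * l by omega] at this
        exact this.mpr (Nat.coprime_one_right _)
      rw [hm, hl]
      exact Nat.Coprime.mul_right h h'
    · by_cases hl0 : l = 0
      · exact ⟨1, by omega, Nat.coprime_one_left _, by omega, by omega⟩
      · refine ⟨2 * l - 1, by omega, ?_, by omega, by omega⟩
        have h : (2 * l - 1).Coprime 2 := by
          rw [Nat.coprime_two_right]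
          exact ⟨l - 1, by omega⟩
        have h' : (2 * l - 1).Coprime (2 * l + 1) := by
          have := Nat.coprime_self_add_right (m := 2 * l - 1) (n := 2)
          rw [show 2 * l - 1 + 2 = 2 * l + 1 by omega] at this
          exact this.mpr h
        rw [hm, hl]
        exact Nat.Coprime.mul_right h h'
  · refine ⟨m, by omega, ?_, by omega, by omega⟩
    rw [hm]
    exact (Nat.coprime_mul_right_add_right m 1 2).mpr (Nat.coprime_one_right _)

/-! ### Random sign vectors -/

/-- The sign `±1` of a bit. -/
def bitSign (b : Bool) : ℝ := if b then 1 else -1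

lemma bitSign_mul_self (b : Bool) : bitSign b * bitSign b = 1 := by
  cases b <;> simp [bitSign]

/-- The normalized inner product of two sign vectors. -/
noncomputable def signCorr {n : ℕ} (v v' : Fin n → Bool) : ℝ :=
  (∑ i, bitSign (v i) * bitSign (v' i)) / n

lemma sum_exp_signCorr {n : ℕ} (v : Fin n → Bool) (c : ℝ) :
    ∑ v' : Fin n → Bool, Real.exp (c * ∑ i, bitSign (v i) * bitSign (v' i)) =
      (2 * Real.cosh c) ^ n := by
  have h (v' : Fin n → Bool) : Real.exp (c * ∑ i, bitSign (v i) * bitSign (v' i)) =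
      ∏ i, Real.exp (c * (bitSign (v i) * bitSign (v' i))) := by
    rw [Finset.mul_sum, Real.exp_sum]
  simp_rw [h]
  rw [← Fintype.prod_sum (fun i b => Real.exp (c * (bitSign (v i) * bitSign b)))]
  have h2 (i : Fin n) : ∑ b, Real.exp (c * (bitSign (v i) * bitSign b)) = 2 * Real.cosh c := by
    rw [Fintype.sum_bool, Real.cosh_eq]
    cases v i <;> simp [bitSign] <;> ring
  rw [Finset.prod_congr rfl fun i _ => h2 i]
  simp

open Classical in
lemma card_lt_signCorr_le {n : ℕ} (v : Fin n → Bool) {t : ℝ} (ht : 0 ≤ t) (e : ℝ)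
    (he : e = 1 ∨ e = -1) :
    (((Finset.univ.filter fun v' => t < e * signCorr v v').card : ℕ) : ℝ) ≤
      2 ^ n * Real.exp (-(n * t ^ 2 / 2)) := by
  rcases Nat.eq_zero_or_pos n with rfl | hn
  · simp [signCorr, not_lt.mpr ht]
  have hn' : (0 : ℝ) < n := by exact_mod_cast hn
  have he2 : e ^ 2 = 1 := by rcases he with rfl | rfl <;> norm_num
  have h1 : (((Finset.univ.filter fun v' => t < e * signCorr v v').card : ℕ) : ℝ) *
      Real.exp (t * (n * t)) ≤ (2 * Real.cosh (e * t)) ^ n := by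
    rw [← sum_exp_signCorr v, ← nsmul_eq_mul, ← Finset.sum_const]
    refine (Finset.sum_le_sum fun v' hv' => ?_).trans
      (Finset.sum_le_sum_of_subset_of_nonneg (Finset.filter_subset _ _)
        fun _ _ _ => Real.exp_nonneg _)
    rw [Finset.mem_filter, signCorr, mul_div_assoc', lt_div_iff₀ hn'] at hv'
    apply Real.exp_le_exp.mpr
    calc t * (n * t) = t * (t * n) := by ring
      _ ≤ t * (e * ∑ i, bitSign (v i) * bitSign (v' i)) :=
        mul_le_mul_of_nonneg_left hv'.2.le ht
      _ = _ := by ring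
  have h2 : (2 * Real.cosh (e * t)) ^ n ≤ 2 ^ n * Real.exp (n * (t ^ 2 / 2)) := by
    rw [mul_pow, Real.exp_nat_mul]
    gcongr
    have := Real.cosh_le_exp_half_sq (e * t)
    rwa [mul_pow, he2, one_mul] at this
  rw [show -(n * t ^ 2 / 2) = n * (t ^ 2 / 2) - t * (n * t) by ring, Real.exp_sub, ← mul_div_assoc,
    le_div_iff₀ (Real.exp_pos _)]
  exact h1.trans h2

open Classical in
lemma card_lt_abs_signCorr_le {n : ℕ} (v : Fin n → Bool) {t : ℝ} (ht : 0 ≤ t) :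
    (((Finset.univ.filter fun v' => t < |signCorr v v'|).card : ℕ) : ℝ) ≤
      2 * 2 ^ n * Real.exp (-(n * t ^ 2 / 2)) := by
  have hsub : (Finset.univ.filter fun v' => t < |signCorr v v'|) ⊆
      (Finset.univ.filter fun v' => t < 1 * signCorr v v') ∪
        (Finset.univ.filter fun v' => t < -1 * signCorr v v') := by
    intro v' hv'
    simpa [lt_abs] using hv'
  have h1 := card_lt_signCorr_le v ht 1 (.inl rfl)
  have h2 := card_lt_signCorr_le v ht (-1) (.inr rfl)
  have h3 : (((Finset.univ.filter fun v' => t < |signCorr v v'|).card : ℕ) : ℝ) ≤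
      ((Finset.univ.filter fun v' => t < 1 * signCorr v v').card : ℝ) +
        ((Finset.univ.filter fun v' => t < -1 * signCorr v v').card : ℝ) := by
    exact_mod_cast (Finset.card_le_card hsub).trans (Finset.card_union_le _ _)
  linarith

lemma signCorr_self {n : ℕ} (hn : 0 < n) (v : Fin n → Bool) : signCorr v v = 1 := by
  have : (n : ℝ) ≠ 0 := by exact_mod_cast hn.ne'
  simp [signCorr, bitSign_mul_self, this]

open Classical in
/-- A kernel on sign vectors which is bounded by `1`, and by `ε` on pairs with small inner product,
is small on average over every large set. -/
lemma sum_sum_le_of_signCorr {n : ℕ} {F : (Fin n → Bool) → (Fin n → Bool) → ℝ} {t ε τ : ℝ}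
    (ht : 0 ≤ t) (hε : 0 ≤ ε) (hτ : 0 < τ) (hF1 : ∀ v v', F v v' ≤ 1)
    (hF : ∀ v v', |signCorr v v'| ≤ t → F v v' ≤ ε) (B : Finset (Fin n → Bool))
    (hB : τ * 2 ^ n ≤ B.card) :
    ∑ v ∈ B, ∑ v' ∈ B, F v v' ≤
      (ε + 2 * Real.exp (-(n * t ^ 2 / 2)) / τ) * (B.card : ℝ) ^ 2 := by
  have h1 (v : Fin n → Bool) : ∑ v' ∈ B, F v v' ≤
      ε * B.card + 2 * 2 ^ n * Real.exp (-(n * t ^ 2 / 2)) := by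
    calc ∑ v' ∈ B, F v v' ≤ ∑ v' ∈ B, (ε + if t < |signCorr v v'| then 1 else 0) := by
          refine Finset.sum_le_sum fun v' _ => ?_
          split_ifs with h
          · linarith [hF1 v v']
          · linarith [hF v v' (not_lt.mp h)]
      _ = ε * B.card + ∑ v' ∈ B, (if t < |signCorr v v'| then (1 : ℝ) else 0) := by
          rw [Finset.sum_add_distrib, Finset.sum_const, nsmul_eq_mul, mul_comm]
      _ ≤ ε * B.card + ∑ v', (if t < |signCorr v v'| then (1 : ℝ) else 0) := by
          gcongr
          exact Finset.subset_univ _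
      _ ≤ _ := by
          gcongr
          rw [Finset.sum_boole]
          exact card_lt_abs_signCorr_le v ht
  calc _ ≤ ∑ v ∈ B, (ε * B.card + 2 * 2 ^ n * Real.exp (-(n * t ^ 2 / 2))) :=
        Finset.sum_le_sum fun v _ => h1 v
    _ = ε * (B.card : ℝ) ^ 2 + B.card * (2 * Real.exp (-(n * t ^ 2 / 2)) / τ) * (τ * 2 ^ n) := by
        rw [Finset.sum_const, nsmul_eq_mul]
        field_simp
    _ ≤ ε * (B.card : ℝ) ^ 2 + B.card * (2 * Real.exp (-(n * t ^ 2 / 2)) / τ) * B.card := by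
        gcongr
    _ = _ := by ring

/-! ### Statistical query lower bounds from pairwise correlations -/

section correlation

variable {X : Type*} [MeasurableSpace X] {P₀ : Measure X} [IsProbabilityMeasure P₀]

/-- Boundedness and measurability, as needed for integrability over a probability space. -/
structure IsBoundedMeasurable (f : X → ℝ) : Prop where
  measurable : Measurable f
  bounded : ∃ C, ∀ x, |f x| ≤ C

namespace IsBoundedMeasurable

variable {f g : X → ℝ}

lemma integrable {P : Measure X} [IsFiniteMeasure P] (hf : IsBoundedMeasurable f) :
    Integrable f P :=
  let ⟨C, hC⟩ := hf.bounded
  Integrable.of_bound hf.measurable.aestronglyMeasurable C (.of_forall hC)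

lemma mul (hf : IsBoundedMeasurable f) (hg : IsBoundedMeasurable g) :
    IsBoundedMeasurable (fun x => f x * g x) := by
  obtain ⟨C, hC⟩ := hf.bounded
  obtain ⟨C', hC'⟩ := hg.bounded
  refine ⟨hf.measurable.mul hg.measurable, C * C', fun x => ?_⟩
  rw [abs_mul]
  exact mul_le_mul (hC x) (hC' x) (abs_nonneg _) ((abs_nonneg _).trans (hC x))

lemma const (c : ℝ) : IsBoundedMeasurable (fun _ : X => c) :=
  ⟨measurable_const, |c|, fun _ => le_rfl⟩

lemma sub_const (hf : IsBoundedMeasurable f) (c : ℝ) : IsBoundedMeasurable (fun x => f x - c) := by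
  obtain ⟨C, hC⟩ := hf.bounded
  exact ⟨hf.measurable.sub_const c, C + |c|, fun x =>
    (abs_sub _ _).trans (add_le_add_left (hC x) _)⟩

lemma sq (hf : IsBoundedMeasurable f) : IsBoundedMeasurable (fun x => f x ^ 2) := by
  simpa [pow_two] using hf.mul hf

lemma sum {ι : Type*} {s : Finset ι} {F : ι → X → ℝ} (h : ∀ i, IsBoundedMeasurable (F i)) :
    IsBoundedMeasurable (fun x => ∑ i ∈ s, F i x) := by
  choose C hC using fun i => (h i).bounded
  exact ⟨Finset.measurable_sum _ fun i _ => (h i).measurable, ∑ i ∈ s, C i, fun x =>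
    (Finset.abs_sum_le_sum_abs _ _).trans (Finset.sum_le_sum fun i _ => hC i x)⟩

end IsBoundedMeasurable

lemma sq_integral_mul_le {f g : X → ℝ} (hf : IsBoundedMeasurable f) (hg : IsBoundedMeasurable g) :
    (∫ x, f x * g x ∂P₀) ^ 2 ≤ (∫ x, f x ^ 2 ∂P₀) * ∫ x, g x ^ 2 ∂P₀ := by
  have h (l : ℝ) : 0 ≤ (∫ x, g x ^ 2 ∂P₀) * (l * l) + (2 * ∫ x, f x * g x ∂P₀) * l +
      ∫ x, f x ^ 2 ∂P₀ := by
    have h1 : ∫ x, (l * g x + f x) ^ 2 ∂P₀ = (∫ x, g x ^ 2 ∂P₀) * (l * l) +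
        (2 * ∫ x, f x * g x ∂P₀) * l + ∫ x, f x ^ 2 ∂P₀ := by
      have h2 (x : X) : (l * g x + f x) ^ 2 =
          (l * l) * g x ^ 2 + (2 * l) * (f x * g x) + f x ^ 2 := by ring
      simp_rw [h2]
      have i1 : Integrable (fun x => (l * l) * g x ^ 2) P₀ := hg.sq.integrable.const_mul _
      have i2 : Integrable (fun x => (2 * l) * (f x * g x)) P₀ :=
        (hf.mul hg).integrable.const_mul _
      have i3 : Integrable (fun x => (l * l) * g x ^ 2 + (2 * l) * (f x * g x)) P₀ := i1.add i2
      rw [integral_add i3 hf.sq.integrable, integral_add i1 i2, integral_const_mul,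
        integral_const_mul]
      ring
    rw [← h1]
    exact integral_nonneg fun x => sq_nonneg _
  have := discrim_le_zero h
  rw [discrim] at this
  nlinarith

variable {V : Type*} {g : V → X → ℝ} {τ ε : ℝ}

/-- A Bessel-type inequality for functions with small correlations. -/
lemma sq_sum_abs_integral_mul_le (hg : ∀ v, IsBoundedMeasurable (g v)) {q : X → ℝ}
    (hq : IsBoundedMeasurable q) (B : Finset V) :
    (∑ v ∈ B, |∫ x, q x * g v x ∂P₀|) ^ 2 ≤
      (∫ x, q x ^ 2 ∂P₀) * ∑ v ∈ B, ∑ v' ∈ B, |∫ x, g v x * g v' x ∂P₀| := by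
  set s : V → ℝ := fun v => SignType.sign (∫ x, q x * g v x ∂P₀) with hs
  have hs1 (v : V) : |s v| ≤ 1 := by
    rw [hs]
    rcases lt_trichotomy (∫ x, q x * g v x ∂P₀) 0 with h | h | h <;> simp [h]
  have hsg (v : V) : IsBoundedMeasurable (fun x => s v * g v x) :=
    (IsBoundedMeasurable.const _).mul (hg v)
  have h1 : ∑ v ∈ B, |∫ x, q x * g v x ∂P₀| = ∫ x, q x * ∑ v ∈ B, s v * g v x ∂P₀ := by
    simp_rw [Finset.mul_sum]
    rw [integral_finsetSum _ fun v _ => (hq.mul (hsg v)).integrable]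
    refine Finset.sum_congr rfl fun v _ => ?_
    rw [← sign_mul_self, ← integral_const_mul]
    exact integral_congr_ae (.of_forall fun x => by simp only [hs]; ring)
  rw [h1]
  refine (sq_integral_mul_le hq (IsBoundedMeasurable.sum hsg)).trans ?_
  refine mul_le_mul_of_nonneg_left ?_ (integral_nonneg fun x => sq_nonneg _)
  have h2 : ∫ x, (∑ v ∈ B, s v * g v x) ^ 2 ∂P₀ =
      ∑ v ∈ B, ∑ v' ∈ B, s v * s v' * ∫ x, g v x * g v' x ∂P₀ := by
    simp_rw [pow_two, Finset.sum_mul_sum]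
    rw [integral_finsetSum _ fun v _ =>
      (IsBoundedMeasurable.sum fun v' => (hsg v).mul (hsg v')).integrable]
    refine Finset.sum_congr rfl fun v _ => ?_
    rw [integral_finsetSum _ fun v' _ => ((hsg v).mul (hsg v')).integrable]
    refine Finset.sum_congr rfl fun v' _ => ?_
    rw [← integral_const_mul]
    exact integral_congr_ae (.of_forall fun x => by ring)
  rw [h2]
  refine Finset.sum_le_sum fun v _ => Finset.sum_le_sum fun v' _ => (le_abs_self _).trans ?_
  rw [abs_mul, abs_mul]
  exact mul_le_of_le_one_left (abs_nonneg _) (mul_le_one₀ (hs1 v) (abs_nonneg _) (hs1 v'))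

variable [Fintype V]

/-- The functions `g v` have average correlation at most `ε` over every subset of `V` of density at
least `τ`. -/
def HasSmallCorrelations (P₀ : Measure X) (g : V → X → ℝ) (τ ε : ℝ) : Prop :=
  ∀ B : Finset V, τ * Fintype.card V ≤ B.card →
    ∑ v ∈ B, ∑ v' ∈ B, |∫ x, g v x * g v' x ∂P₀| ≤ ε * (B.card : ℝ) ^ 2

lemma HasSmallCorrelations.exists_sq_integral_mul_le (hcorr : HasSmallCorrelations P₀ g τ ε)
    (hε : 0 ≤ ε) (hg : ∀ v, IsBoundedMeasurable (g v)) {q : X → ℝ} (hq : IsBoundedMeasurable q)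
    {B : Finset V} (hB : τ * Fintype.card V ≤ B.card) (hne : B.Nonempty) :
    ∃ v ∈ B, (∫ x, q x * g v x ∂P₀) ^ 2 ≤ ε * ∫ x, q x ^ 2 ∂P₀ := by
  by_contra! h
  have hS : 0 ≤ ∫ x, q x ^ 2 ∂P₀ := integral_nonneg fun x => sq_nonneg _
  have h1 := sq_sum_abs_integral_mul_le (P₀ := P₀) hg hq B
  have h2 : (B.card : ℝ) * Real.sqrt (ε * ∫ x, q x ^ 2 ∂P₀) <
      ∑ v ∈ B, |∫ x, q x * g v x ∂P₀| := by
    rw [← nsmul_eq_mul, ← Finset.sum_const]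
    refine Finset.sum_lt_sum_of_nonempty hne fun v hv => ?_
    rw [← Real.sqrt_sq_eq_abs]
    exact Real.sqrt_lt_sqrt (by positivity) (h v hv)
  have h3 := pow_lt_pow_left₀ h2 (by positivity) two_ne_zero
  rw [mul_pow, Real.sq_sqrt (by positivity)] at h3
  have h4 := mul_le_mul_of_nonneg_left (hcorr B hB) hS
  nlinarith

open Classical in
/-- If the `P v` have densities `1 - g v` with respect to `P₀` and the `g v` have small correlations,
then the expectation of a query under `P₀` is a valid `VSTAT` answer for most `P v`. -/
lemma HasSmallCorrelations.card_not_valid_le [Nonempty V] (hcorr : HasSmallCorrelations P₀ g τ ε)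
    (hε : 0 ≤ ε) (hτ : 0 < τ) (hg : ∀ v, IsBoundedMeasurable (g v))
    {P : V → Measure X} [∀ v, IsProbabilityMeasure (P v)]
    (hP : ∀ v, ∀ f : X → ℝ, IsBoundedMeasurable f →
      ∫ x, f x ∂P v = ∫ x, f x ∂P₀ - ∫ x, f x * g v x ∂P₀)
    (q : StatQuery X) {u : ℝ} (hu : 0 < u) (huε : 16 * (u + 1) * ε ≤ 1) :
    ((Finset.univ.filter fun v => ¬ |∫ x, q.toFun x ∂P₀ - ∫ x, q.toFun x ∂P v| ≤
      max (1 / u) (Real.sqrt (variance q.toFun (P v) / u))).card : ℝ) ≤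
      2 * τ * Fintype.card V := by
  have hq : IsBoundedMeasurable q.toFun :=
    ⟨q.measurable_toFun, 1, fun x => abs_le.mpr (q.mem_Icc x)⟩
  set m := ∫ x, q.toFun x ∂P₀ with hm
  have hm1 : |m| ≤ 1 := by
    have := norm_integral_le_of_norm_le_const (μ := P₀) (f := q.toFun) (C := 1)
      (.of_forall fun x => abs_le.mpr (q.mem_Icc x))
    simpa using this
  set q₀ : X → ℝ := fun x => q.toFun x - m with hq₀
  have hq₀b : IsBoundedMeasurable q₀ := hq.sub_const m
  have hq₀2 (x : X) : |q₀ x| ≤ 2 := by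
    have := abs_sub (q.toFun x) m
    have h2 : |q.toFun x| ≤ 1 := abs_le.mpr (q.mem_Icc x)
    exact this.trans (by linarith)
  set S := ∫ x, q₀ x ^ 2 ∂P₀ with hS
  have hS0 : 0 ≤ S := integral_nonneg fun x => sq_nonneg _
  set Δ : V → ℝ := fun v => ∫ x, q₀ x * g v x ∂P₀ with hΔ
  set Δ' : V → ℝ := fun v => ∫ x, q₀ x ^ 2 * g v x ∂P₀ with hΔ'
  have hmean (v : V) : ∫ x, q₀ x ∂P v = - Δ v := by
    rw [hP v _ hq₀b]
    simp only [hq₀, hΔ]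
    rw [integral_sub hq.integrable (integrable_const _)]
    simp [hm]
  have hdiff (v : V) : m - ∫ x, q.toFun x ∂P v = Δ v := by
    have := hmean v
    simp only [hq₀] at this
    rw [integral_sub hq.integrable (integrable_const _)] at this
    simp at this
    linarith
  have hvar (v : V) : variance q.toFun (P v) = S - Δ' v - Δ v ^ 2 := by
    have h1 : variance q₀ (P v) = variance q.toFun (P v) := by
      rw [hq₀]; exact variance_sub_const hq.measurable.aestronglyMeasurable m
    have hLp : MemLp q₀ 2 (P v) :=
      MemLp.of_bound hq₀b.measurable.aestronglyMeasurable 2 (.of_forall hq₀2)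
    rw [← h1, variance_eq_sub hLp, hmean]
    have := hP v _ hq₀b.sq
    simp only [Pi.pow_apply]
    rw [this]
    ring
  have hinv : 0 < 1 / u := by positivity
  set B₁ := Finset.univ.filter fun v => S / 2 < (u + 1) * Δ v ^ 2
  set B₂ := Finset.univ.filter fun v => S / 2 < Δ' v ∧ 1 / u < |Δ v|
  have hcard : (0 : ℝ) < Fintype.card V := by exact_mod_cast Fintype.card_pos
  have hne {B : Finset V} (hB : τ * Fintype.card V ≤ B.card) : B.Nonempty := by
    rw [← Finset.card_pos]
    have : (0 : ℝ) < B.card := lt_of_lt_of_le (by positivity) hB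
    exact_mod_cast this
  have hB₁ : (B₁.card : ℝ) ≤ τ * Fintype.card V := by
    by_contra! h
    obtain ⟨v, hv, hle⟩ := hcorr.exists_sq_integral_mul_le hε hg hq₀b h.le (hne h.le)
    have h1 : S / 2 < (u + 1) * Δ v ^ 2 := (Finset.mem_filter.mp hv).2
    have h2 : (u + 1) * Δ v ^ 2 ≤ (u + 1) * (ε * S) := by gcongr
    nlinarith
  have hB₂ : (B₂.card : ℝ) ≤ τ * Fintype.card V := by
    by_contra! h
    obtain ⟨v, hv, hle⟩ := hcorr.exists_sq_integral_mul_le hε hg hq₀b.sq h.le (hne h.le)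
    obtain ⟨w, hw, hle'⟩ := hcorr.exists_sq_integral_mul_le hε hg hq₀b h.le (hne h.le)
    have h1 : S / 2 < Δ' v := (Finset.mem_filter.mp hv).2.1
    have h2 : 1 / u < |Δ w| := (Finset.mem_filter.mp hw).2.2
    have h4 : ∫ x, (q₀ x ^ 2) ^ 2 ∂P₀ ≤ 4 * S := by
      rw [hS, ← integral_const_mul]
      refine integral_mono hq₀b.sq.sq.integrable (hq₀b.sq.integrable.const_mul _) fun x => ?_
      have : q₀ x ^ 2 ≤ 4 := by
        have := sq_le_sq' (by linarith [(abs_le.mp (hq₀2 x)).1]) (abs_le.mp (hq₀2 x)).2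
        linarith
      have h0 := sq_nonneg (q₀ x)
      change (q₀ x ^ 2) ^ 2 ≤ 4 * q₀ x ^ 2
      nlinarith
    have h5 : Δ' v ^ 2 ≤ 4 * ε * S := by
      refine hle.trans ?_
      calc _ ≤ ε * (4 * S) := by gcongr
        _ = _ := by ring
    have h6 : S * S < 16 * ε * S ∨ S = 0 := by
      rcases hS0.eq_or_lt with h0 | h0
      · exact .inr h0.symm
      · left; nlinarith
    have h7 : S ≤ 16 * ε := by
      rcases h6 with h6 | h6
      · by_contra! h7
        nlinarith
      · rw [h6]; positivity
    have h8 : (1 / u) ^ 2 < 16 * ε * ε := by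
      calc (1 / u) ^ 2 < |Δ w| ^ 2 := by gcongr
        _ = Δ w ^ 2 := sq_abs _
        _ ≤ ε * S := hle'
        _ ≤ ε * (16 * ε) := by gcongr
        _ = _ := by ring
    have h9 : 1 < 16 * (u * ε) ^ 2 := by
      rw [div_pow, one_pow, div_lt_iff₀ (by positivity)] at h8
      calc 1 < _ := h8
        _ = _ := by ring
    have h10 : 0 ≤ u * ε := by positivity
    have h11 : 16 * (u * ε) ≤ 1 := by nlinarith
    nlinarith
  have hsub : (Finset.univ.filter fun v => ¬ |m - ∫ x, q.toFun x ∂P v| ≤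
      max (1 / u) (Real.sqrt (variance q.toFun (P v) / u))) ⊆ B₁ ∪ B₂ := by
    intro v hv
    have h1 := (Finset.mem_filter.mp hv).2
    rw [hdiff, not_le, max_lt_iff] at h1
    have h2 : variance q.toFun (P v) / u < Δ v ^ 2 := by
      rw [← sq_abs]
      exact Real.lt_sq_of_sqrt_lt h1.2
    rw [div_lt_iff₀ hu, hvar] at h2
    rw [Finset.mem_union]
    by_cases h3 : S / 2 < Δ' v
    · exact .inr (Finset.mem_filter.mpr ⟨Finset.mem_univ _, h3, h1.1⟩)
    · refine .inl (Finset.mem_filter.mpr ⟨Finset.mem_univ _, ?_⟩)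
      push Not at h3
      nlinarith
  have h1 : ((Finset.univ.filter fun v => ¬ |m - ∫ x, q.toFun x ∂P v| ≤
      max (1 / u) (Real.sqrt (variance q.toFun (P v) / u))).card : ℝ) ≤ B₁.card + B₂.card := by
    exact_mod_cast (Finset.card_le_card hsub).trans (Finset.card_union_le _ _)
  linarith

end correlation

section simulation

variable {X : Type*} [MeasurableSpace X]

/-- Two oracles which agree on the admissible queries that an algorithm asks lead to the same
output. -/
lemma SQAlgorithm.run_eq_run {H : Type*} {U : ℝ} {O O' : SQOracle X} (A : SQAlgorithm X H) (M : ℕ)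
    (hlen : (A.queries O').length ≤ M) (hU : ∀ p ∈ A.queries O', (p.2 : ℝ) < U)
    (hagree : ∀ p ∈ (A.queries O).take M, (p.2 : ℝ) < U → O' p.1 p.2 = O p.1 p.2) :
    A.run O' = A.run O := by
  induction A generalizing M with
  | output h => rfl
  | query q u next ih =>
    simp only [SQAlgorithm.queries, SQAlgorithm.run] at *
    obtain ⟨M, rfl⟩ : ∃ M', M = M' + 1 := ⟨M - 1, by simp at hlen; omega⟩
    have hq : O' q u = O q u := hagree (q, u) (by simp) (hU (q, u) (by simp))
    rw [hq] at hlen hU ⊢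
    refine ih _ M (by simpa using hlen) (fun p hp => hU p (List.mem_cons_of_mem _ hp))
      fun p hp => hagree p ?_
    rw [List.take_succ_cons]
    exact List.mem_cons_of_mem _ hp

open Classical in
/-- The oracle for `D` that answers with expectations under `P₀` whenever this is valid. -/
noncomputable def referenceOracle (P₀ D : Measure X) : SQOracle X := fun q u =>
  if |∫ x, q.toFun x ∂P₀ - ∫ x, q.toFun x ∂D| ≤
      max (1 / (u : ℝ)) (Real.sqrt (variance q.toFun D / (u : ℝ)))
    then ∫ x, q.toFun x ∂P₀ else ∫ x, q.toFun x ∂D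

lemma isVSTAT_referenceOracle (P₀ D : Measure X) : IsVSTAT D (referenceOracle P₀ D) := by
  intro q u
  rw [referenceOracle]
  split_ifs with h
  · exact h
  · rw [sub_self, abs_zero]
    exact le_max_of_le_left (by have := u.2; positivity)

open Classical in
/-- A randomized algorithm making few queries, each to an oracle of small parameter, produces the
same output for at least half of the indices. -/
lemma exists_common_output {V : Type*} [Fintype V] {H : Type*} {P₀ : Measure X}
    {P : V → Measure X} {δ U : ℝ} {M : ℕ}
    (hvalid : ∀ (q : StatQuery X) (u : ℝ), 0 < u → u < U →
      ((Finset.univ.filter fun v => ¬ |∫ x, q.toFun x ∂P₀ - ∫ x, q.toFun x ∂P v| ≤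
        max (1 / u) (Real.sqrt (variance q.toFun (P v) / u))).card : ℝ) ≤ δ * Fintype.card V)
    (hδ0 : 0 ≤ δ) (hδ : M * δ ≤ 1 / 6) {Ω : Type*} [MeasurableSpace Ω] {μ : Measure Ω}
    [IsProbabilityMeasure μ] (A : Ω → SQAlgorithm X H) (R : V → H → Prop)
    (hR : ∀ v O, IsVSTAT (P v) O → ∃ G : Set Ω, MeasurableSet G ∧ (2 / 3 : ℝ≥0∞) ≤ μ G ∧
      ∀ ω ∈ G, R v ((A ω).run O))
    (hlow : ∀ v O, IsVSTAT (P v) O → μ {ω | (M : ℝ) < (((A ω).queries O).length : ℝ) ∨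
      ∃ p ∈ (A ω).queries O, U ≤ (p.2 : ℝ)} = 0) :
    ∃ (h : H) (B : Finset V), (Fintype.card V : ℝ) / 2 ≤ B.card ∧ ∀ v ∈ B, R v h := by
  set O' : V → SQOracle X := fun v => referenceOracle P₀ (P v)
  have hO' (v : V) : IsVSTAT (P v) (O' v) := isVSTAT_referenceOracle _ _
  choose G hGm hG hGR using fun v => hR v (O' v) (hO' v)
  set Z : V → Set Ω := fun v => toMeasurable μ {ω | (M : ℝ) < (((A ω).queries (O' v)).length : ℝ) ∨
      ∃ p ∈ (A ω).queries (O' v), U ≤ (p.2 : ℝ)}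
  have hZ (v : V) : μ (Z v) = 0 := by rw [measure_toMeasurable]; exact hlow v _ (hO' v)
  have hG'm (v : V) : MeasurableSet (G v \ Z v) := (hGm v).diff (measurableSet_toMeasurable _ _)
  have hG' (v : V) : (2 / 3 : ℝ≥0∞) ≤ μ (G v \ Z v) := by
    rw [measure_sdiff_null (hZ v)]; exact hG v
  have hint : (Fintype.card V : ℝ≥0∞) * (2 / 3) ≤
      ∫⁻ ω, ∑ v, (G v \ Z v).indicator 1 ω ∂μ := by
    rw [lintegral_finsetSum _ fun v _ => measurable_one.indicator (hG'm v)]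
    simp_rw [lintegral_indicator_one (hG'm _)]
    refine le_trans ?_ (Finset.sum_le_sum fun v _ => hG' v)
    rw [Finset.sum_const, nsmul_eq_mul, Finset.card_univ]
  have hsum (ω : Ω) : ∑ v, (G v \ Z v).indicator (1 : Ω → ℝ≥0∞) ω =
      ((Finset.univ.filter fun v => ω ∈ G v \ Z v).card : ℝ≥0∞) := by
    simp only [Set.indicator_apply, Pi.one_apply]
    rw [Finset.sum_boole]
  simp_rw [hsum] at hint
  obtain ⟨ω, hω⟩ : ∃ ω, ∫⁻ ω, ((Finset.univ.filter fun v => ω ∈ G v \ Z v).card : ℝ≥0∞) ∂μ ≤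
      ((Finset.univ.filter fun v => ω ∈ G v \ Z v).card : ℝ≥0∞) := by
    apply exists_lintegral_le
    refine ne_top_of_le_ne_top (b := (Fintype.card V : ℝ≥0∞)) (by simp) ?_
    calc _ ≤ ∫⁻ _, (Fintype.card V : ℝ≥0∞) ∂μ :=
          lintegral_mono fun ω => Nat.cast_le.mpr (Finset.card_le_univ _)
      _ = _ := by simp
  set B₁ := Finset.univ.filter fun v => ω ∈ G v \ Z v
  have hB₁ : (Fintype.card V : ℝ) * (2 / 3) ≤ B₁.card := by
    have := ENNReal.toReal_mono (by simp) (hint.trans hω)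
    simpa [ENNReal.toReal_mul, ENNReal.toReal_div] using this
  set O : SQOracle X := fun q _ => ∫ x, q.toFun x ∂P₀
  set a := A ω
  set L := (a.queries O).take M
  set bad : StatQuery X × {u : ℝ // 0 < u} → Finset V := fun p =>
    if (p.2 : ℝ) < U then Finset.univ.filter fun v =>
      ¬ |∫ x, p.1.toFun x ∂P₀ - ∫ x, p.1.toFun x ∂P v| ≤
        max (1 / (p.2 : ℝ)) (Real.sqrt (variance p.1.toFun (P v) / (p.2 : ℝ))) else ∅ with hbad
  have hbadcard (p) : ((bad p).card : ℝ) ≤ δ * Fintype.card V := by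
    simp only [hbad]
    split_ifs with h
    · exact hvalid p.1 p.2 p.2.2 h
    · simp; positivity
  set B₂ := L.toFinset.biUnion bad
  have hB₂ : (B₂.card : ℝ) ≤ 1 / 6 * Fintype.card V := by
    calc (B₂.card : ℝ) ≤ ∑ p ∈ L.toFinset, ((bad p).card : ℝ) := by
          exact_mod_cast Finset.card_biUnion_le
      _ ≤ ∑ p ∈ L.toFinset, δ * Fintype.card V := Finset.sum_le_sum fun p _ => hbadcard p
      _ = L.toFinset.card * (δ * Fintype.card V) := by rw [Finset.sum_const, nsmul_eq_mul]
      _ ≤ M * (δ * Fintype.card V) := by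
          gcongr
          exact (List.toFinset_card_le L).trans (List.length_take_le _ _)
      _ = M * δ * Fintype.card V := by ring
      _ ≤ _ := by gcongr
  refine ⟨a.run O, B₁ \ B₂, ?_, fun v hv => ?_⟩
  · have h1 : (B₁.card : ℝ) ≤ (B₁ \ B₂).card + B₂.card := by
      have := Finset.le_card_sdiff B₂ B₁
      have h2 : B₁.card ≤ (B₁ \ B₂).card + B₂.card := by omega
      exact_mod_cast h2
    linarith
  · rw [Finset.mem_sdiff] at hv
    have h1 : ω ∈ G v \ Z v := (Finset.mem_filter.mp hv.1).2
    have h2 : ω ∉ {ω | (M : ℝ) < (((A ω).queries (O' v)).length : ℝ) ∨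
      ∃ p ∈ (A ω).queries (O' v), U ≤ (p.2 : ℝ)} := fun h => h1.2 (subset_toMeasurable _ _ h)
    simp only [Set.mem_ofPred_eq, not_or, not_lt, not_exists, not_and, not_le] at h2
    have hrun : a.run (O' v) = a.run O := by
      refine a.run_eq_run M (by exact_mod_cast h2.1) (U := U) h2.2 fun p hp hpU => ?_
      have h3 : v ∉ bad p := fun h => hv.2 (Finset.mem_biUnion.mpr ⟨p, List.mem_toFinset.mpr hp, h⟩)
      simp only [hbad, if_pos hpU, Finset.mem_filter, Finset.mem_univ, true_and, not_not] at h3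
      exact if_pos h3
    rw [← hrun]
    exact hGR v ω h1.1

end simulation

/-! ### Hidden planes -/

section plane

variable {E : Type*} [NormedAddCommGroup E] [InnerProductSpace ℝ E] {n : ℕ}

/-- The linear map to the plane spanned by the vectors with normalized sign coordinates `v` in the
first and in the second half of the orthonormal family `e`. -/
noncomputable def hiddenCoord (e : Fin n ⊕ Fin n → E) (v : Fin n → Bool) : E →L[ℝ] ℂ :=
  planeCoord (∑ i, (Sum.elim (fun i => bitSign (v i) / Real.sqrt n) 0 i : ℝ) • e i)
    (∑ i, (Sum.elim 0 (fun i => bitSign (v i) / Real.sqrt n) i : ℝ) • e i)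

lemma sum_bitSign_div_sqrt (v v' : Fin n → Bool) :
    ∑ i, bitSign (v i) / Real.sqrt n * (bitSign (v' i) / Real.sqrt n) = signCorr v v' := by
  rw [signCorr, Finset.sum_div]
  refine Finset.sum_congr rfl fun i _ => ?_
  rw [div_mul_div_comm, Real.mul_self_sqrt (Nat.cast_nonneg n)]

lemma map_hiddenCoord_prod_stdGaussian [FiniteDimensional ℝ E] [MeasurableSpace E] [BorelSpace E]
    (hn : 0 < n) {e : Fin n ⊕ Fin n → E} (he : Orthonormal ℝ e) (v v' : Fin n → Bool) {σ : ℝ}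
    (hσ : signCorr v v' ^ 2 + σ ^ 2 = 1) :
    (stdGaussian E).map (fun x => (hiddenCoord e v x, hiddenCoord e v' x)) =
      ((stdGaussian ℂ).prod (stdGaussian ℂ)).map
        (fun p : ℂ × ℂ => (p.1, (signCorr v v' : ℂ) * p.1 + (σ : ℂ) * p.2)) := by
  apply map_planeCoord_prod_stdGaussian hσ <;> rw [he.inner_sum] <;>
  simp only [conj_trivial, Fintype.sum_sum_type, Sum.elim_inl, Sum.elim_inr,
    Pi.zero_apply, mul_zero, zero_mul, Finset.sum_const_zero, add_zero, zero_add,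
    sum_bitSign_div_sqrt, signCorr_self hn]

end plane

section sectorClassifier

variable {d n K : ℕ} [NeZero K]

/-- The classifier given by the sector of the hidden coordinate. -/
noncomputable def sectorClassifier (K : ℕ) [NeZero K]
    (e : Fin n ⊕ Fin n → EuclideanSpace ℝ (Fin d)) (v : Fin n → Bool)
    (x : EuclideanSpace ℝ (Fin d)) : Fin K :=
  sectorIndex K (hiddenCoord e v x)

lemma measurable_sectorClassifier (e : Fin n ⊕ Fin n → EuclideanSpace ℝ (Fin d))
    (v : Fin n → Bool) : Measurable (sectorClassifier K e v) :=
  measurable_sectorIndex.comp (hiddenCoord e v).continuous.measurable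

lemma isLinearClassifier_sectorIndex_planeCoord (a b : EuclideanSpace ℝ (Fin d)) :
    IsLinearClassifier (fun x => sectorIndex K (planeCoord a b x)) := by
  refine ⟨fun i => (unitRoot K ^ (i : ℕ)).re • a + (unitRoot K ^ (i : ℕ)).im • b, 0, fun x => ?_⟩
  have h (i : Fin K) : (inner ℝ ((unitRoot K ^ (i : ℕ)).re • a + (unitRoot K ^ (i : ℕ)).im • b) x +
      (0 : Fin K → ℝ) i : ℝ) = inner ℝ (unitRoot K ^ (i : ℕ)) (planeCoord a b x) := by
    generalize unitRoot K ^ (i : ℕ) = z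
    rw [planeCoord_apply, Complex.inner, inner_add_left, real_inner_smul_left,
      real_inner_smul_left]
    simp
    ring
  simp_rw [h]
  exact sectorIndex_spec _

lemma isLinearClassifier_sectorClassifier (e : Fin n ⊕ Fin n → EuclideanSpace ℝ (Fin d))
    (v : Fin n → Bool) : IsLinearClassifier (sectorClassifier K e v) :=
  isLinearClassifier_sectorIndex_planeCoord _ _

lemma IsBoundedMeasurable.cosKernel {X : Type*} [MeasurableSpace X] {f : X → Fin K}
    (hf : Measurable f) (k : ℕ) (j : Fin K) : IsBoundedMeasurable (fun x => cosKernel K k (f x) j) :=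
  ⟨(measurable_of_countable (fun i => _root_.cosKernel K k i j)).comp hf, 1,
    fun _ => abs_cosKernel_le_one k _ j⟩

lemma abs_cosKernel_mul_le_one (k : ℕ) (i i' j j' : Fin K) :
    |cosKernel K k i j * cosKernel K k i' j'| ≤ 1 := by
  rw [abs_mul]
  exact mul_le_one₀ (abs_cosKernel_le_one _ _ _) (abs_nonneg _) (abs_cosKernel_le_one _ _ _)

end sectorClassifier

lemma exists_abs_integral_cosKernel_mul_le :
    ∃ M C₁ : ℝ, 1 ≤ M ∧ 1 ≤ C₁ ∧ ∀ (d n K k : ℕ) [NeZero K], 0 < n → 2 * k ≤ K →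
      ∀ (e : Fin n ⊕ Fin n → EuclideanSpace ℝ (Fin d)), Orthonormal ℝ e →
      ∀ (v v' : Fin n → Bool), |signCorr v v'| < 1 → ∀ j : Fin K,
        |∫ x, cosKernel K k (sectorClassifier K e v x) j *
            cosKernel K k (sectorClassifier K e v' x) j
          ∂stdGaussian (EuclideanSpace ℝ (Fin d))| ≤ M * (C₁ * |signCorr v v'|) ^ k := by
  obtain ⟨M, C₁, hM, hC₁, h⟩ := exists_abs_integral_correlated_le
  refine ⟨M, C₁, hM, hC₁, fun d n K k _ hn hk e he v v' hr j => ?_⟩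
  have hr2 : 0 < 1 - signCorr v v' ^ 2 := by
    have := (sq_lt_one_iff_abs_lt_one _).mpr hr
    linarith
  have hσ : signCorr v v' ^ 2 + Real.sqrt (1 - signCorr v v' ^ 2) ^ 2 = 1 := by
    rw [Real.sq_sqrt hr2.le]; ring
  have hm : Measurable (fun z => cosKernel K k (sectorIndex K z) j) :=
    (IsBoundedMeasurable.cosKernel measurable_sectorIndex k j).measurable
  have hm2 : Measurable (fun p : ℂ × ℂ => cosKernel K k (sectorIndex K p.1) j *
      cosKernel K k (sectorIndex K p.2) j) :=
    (hm.comp measurable_fst).mul (hm.comp measurable_snd)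
  have key := h k (fun z => cosKernel K k (sectorIndex K z) j)
    (fun z => cosKernel K k (sectorIndex K z) j) hm hm (fun z => abs_cosKernel_le_one _ _ _)
    (fun z => abs_cosKernel_le_one _ _ _) (fun a z ha => by rw [sectorIndex_smul a z ha])
    (fun s m hmk => integral_inner_pow_mul_cosKernel hk hmk s j) _ _ (Real.sqrt_pos.mpr hr2) hσ
  refine le_trans (le_of_eq ?_) key
  congr 1
  have h1 := integral_map (μ := stdGaussian (EuclideanSpace ℝ (Fin d)))
    (φ := fun x => (hiddenCoord e v x, hiddenCoord e v' x))
    (by fun_prop) hm2.aestronglyMeasurable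
  rw [map_hiddenCoord_prod_stdGaussian hn he v v' hσ,
    integral_map (by fun_prop) hm2.aestronglyMeasurable] at h1
  exact h1.symm

/-! ### Contrastive label distributions -/

section contrastive

variable {d K : ℕ}

/-- The distribution of `(x, {j}ᶜ)` where `x` is standard Gaussian and `j` has conditional
probabilities `h x j`. -/
noncomputable def contrastiveMeasure (h : EuclideanSpace ℝ (Fin d) → Fin K → ℝ) :
    Measure (EuclideanSpace ℝ (Fin d) × Finset (Fin K)) :=
  ∑ j, ((stdGaussian (EuclideanSpace ℝ (Fin d))).withDensity
    (fun x => ENNReal.ofReal (h x j))).map (fun x => (x, {j}ᶜ))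

variable {h : EuclideanSpace ℝ (Fin d) → Fin K → ℝ}

lemma contrastiveMeasure_prod (A : Set (EuclideanSpace ℝ (Fin d))) (hA : MeasurableSet A)
    (B : Set (Finset (Fin K))) [DecidablePred (· ∈ B)] :
    contrastiveMeasure h (A ×ˢ B) =
      ∑ j, if {j}ᶜ ∈ B then ∫⁻ x in A, ENNReal.ofReal (h x j)
        ∂stdGaussian (EuclideanSpace ℝ (Fin d)) else 0 := by
  rw [contrastiveMeasure, Measure.coe_finsetSum, Finset.sum_apply]
  refine Finset.sum_congr rfl fun j _ => ?_
  rw [Measure.map_apply measurable_prodMk_right (hA.prod (.of_discrete))]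
  split_ifs with hj
  · rw [← withDensity_apply _ hA]
    congr 1
    ext x
    simp [hj]
  · have : (fun x => (x, ({j}ᶜ : Finset (Fin K)))) ⁻¹' (A ×ˢ B) = ∅ := by
      ext x
      simp [hj]
    rw [this, measure_empty]

lemma contrastiveMeasure_map_fst (hm : ∀ j, Measurable fun x => h x j) (h0 : ∀ x j, 0 ≤ h x j)
    (h1 : ∀ x, ∑ j, h x j = 1) :
    (contrastiveMeasure h).map Prod.fst = stdGaussian (EuclideanSpace ℝ (Fin d)) := by
  classical
  ext A hA
  rw [Measure.map_apply measurable_fst hA, ← Set.prod_univ, contrastiveMeasure_prod A hA]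
  simp only [Set.mem_univ, if_true]
  rw [← lintegral_finsetSum _ fun j _ => (hm j).ennreal_ofReal]
  simp_rw [← ENNReal.ofReal_sum_of_nonneg fun j _ => h0 _ j, h1]
  simp

lemma isProbabilityMeasure_contrastiveMeasure (hm : ∀ j, Measurable fun x => h x j)
    (h0 : ∀ x j, 0 ≤ h x j) (h1 : ∀ x, ∑ j, h x j = 1) :
    IsProbabilityMeasure (contrastiveMeasure h) := by
  constructor
  have := contrastiveMeasure_map_fst hm h0 h1
  have h2 : (contrastiveMeasure h).map Prod.fst Set.univ = 1 := by
    rw [this]; exact measure_univ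
  rwa [Measure.map_apply measurable_fst .univ, Set.preimage_univ] at h2

lemma integral_contrastiveMeasure (hb : ∀ j, IsBoundedMeasurable fun x => h x j)
    (h0 : ∀ x j, 0 ≤ h x j) {q : EuclideanSpace ℝ (Fin d) × Finset (Fin K) → ℝ}
    (hq : IsBoundedMeasurable q) :
    ∫ p, q p ∂contrastiveMeasure h =
      ∑ j, ∫ x, h x j * q (x, {j}ᶜ) ∂stdGaussian (EuclideanSpace ℝ (Fin d)) := by
  have hfin (j : Fin K) : IsFiniteMeasure ((stdGaussian (EuclideanSpace ℝ (Fin d))).withDensity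
      (fun x => ENNReal.ofReal (h x j))) :=
    isFiniteMeasure_withDensity_ofReal (hb j).integrable.2
  rw [contrastiveMeasure, integral_finsetSum_measure fun j _ => ?_]
  · refine Finset.sum_congr rfl fun j _ => ?_
    rw [integral_map measurable_prodMk_right.aemeasurable hq.measurable.aestronglyMeasurable,
      integral_withDensity_eq_integral_toReal_smul (hb j).measurable.ennreal_ofReal (by simp)]
    simp [ENNReal.toReal_ofReal (h0 _ j)]
  · exact hq.integrable

/-- The contrastive confusion matrix in which label `j` is excluded with probability `p i j`. -/
def contrastiveMatrix (p : Fin K → Fin K → ℝ) : Matrix (Fin K) (Finset (Fin K)) ℝ :=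
  fun i S => ∑ j, if S = {j}ᶜ then p i j else 0

variable {p : Fin K → Fin K → ℝ}

lemma contrastiveMatrix_nonneg (h0 : ∀ i j, 0 ≤ p i j) (i : Fin K) (S : Finset (Fin K)) :
    0 ≤ contrastiveMatrix p i S :=
  Finset.sum_nonneg fun j _ => by split_ifs; exacts [h0 i j, le_rfl]

lemma isConfusionMatrix_contrastiveMatrix {γ : ℝ} (f : EuclideanSpace ℝ (Fin d) → Fin K)
    (h0 : ∀ i j, 0 ≤ p i j) (h1 : ∀ i, ∑ j, p i j = 1) (hdiag : ∀ i, p i i = 0)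
    (hγ : ∀ i j, j ≠ i → γ ≤ p i j) : IsConfusionMatrix f γ (contrastiveMatrix p) where
  nonneg := contrastiveMatrix_nonneg h0
  row_sum i := by
    simp only [contrastiveMatrix]
    rw [Finset.sum_comm]
    simp [h1]
  eq_zero i S hi := by
    refine Finset.sum_eq_zero fun j _ => ?_
    split_ifs with hS
    · have : i = j := by simpa [hS] using hi
      rw [← this, hdiag]
    · rfl
  le_missing x y hy := by
    have h2 : contrastiveMatrix p (f x) {y}ᶜ ≤
        ∑ S with y ∉ S, contrastiveMatrix p (f x) S :=
      Finset.single_le_sum (fun S _ => contrastiveMatrix_nonneg h0 (f x) S) (by simp)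
    have h3 : p (f x) y ≤ contrastiveMatrix p (f x) {y}ᶜ := by
      have := Finset.single_le_sum (f := fun j => if ({y}ᶜ : Finset (Fin K)) = {j}ᶜ
        then p (f x) j else 0) (fun j _ => by split_ifs; exacts [h0 _ j, le_rfl])
        (Finset.mem_univ y)
      rwa [if_pos rfl] at this
    exact (hγ _ _ hy).trans (h3.trans h2)

lemma contrastiveMatrix_eq_zero (i : Fin K) (S : Finset (Fin K)) (hS : S.card + 1 ≠ K) :
    contrastiveMatrix p i S = 0 := by
  refine Finset.sum_eq_zero fun j _ => if_neg fun h => hS ?_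
  have := j.2
  rw [h, Finset.card_compl, Finset.card_singleton, Fintype.card_fin]
  omega

lemma hasConfusionMatrix_contrastiveMeasure {f : EuclideanSpace ℝ (Fin d) → Fin K}
    (hf : Measurable f) (h0 : ∀ i j, 0 ≤ p i j) (h1 : ∀ i, ∑ j, p i j = 1) :
    HasConfusionMatrix (contrastiveMeasure fun x j => p (f x) j) f (contrastiveMatrix p) := by
  classical
  intro A T hA
  have hm (j : Fin K) : Measurable fun x => p (f x) j :=
    (measurable_of_countable fun i => p i j).comp hf
  rw [contrastiveMeasure_map_fst hm (fun x j => h0 _ j) (fun x => h1 _),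
    contrastiveMeasure_prod A hA]
  simp only [contrastiveMatrix, Set.mem_singleton_iff]
  have h2 (x : EuclideanSpace ℝ (Fin d)) :
      ENNReal.ofReal (∑ j, if T = {j}ᶜ then p (f x) j else 0) =
        ∑ j, if T = {j}ᶜ then ENNReal.ofReal (p (f x) j) else 0 := by
    rw [ENNReal.ofReal_sum_of_nonneg fun j _ => by split_ifs; exacts [h0 _ j, le_rfl]]
    refine Finset.sum_congr rfl fun j _ => ?_
    split_ifs <;> simp
  simp_rw [h2]
  rw [lintegral_finsetSum _ fun j _ => by
    split_ifs
    exacts [(hm j).ennreal_ofReal, measurable_const]]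
  refine Finset.sum_congr rfl fun j _ => ?_
  by_cases hT : T = {j}ᶜ
  · simp [hT]
  · simp [hT, Ne.symm hT]

end contrastive

/-! ### The hard instances -/

section hard

variable {d K : ℕ}

/-- The query with value `cos (2πk (f x - j) / K)` at `(x, {j}ᶜ)`. -/
noncomputable def kernelQuery (k : ℕ) (f : EuclideanSpace ℝ (Fin d) → Fin K)
    (p : EuclideanSpace ℝ (Fin d) × Finset (Fin K)) : ℝ :=
  ∑ j, if p.2 = {j}ᶜ then cosKernel K k (f p.1) j else 0

lemma kernelQuery_compl_singleton (k : ℕ) (f : EuclideanSpace ℝ (Fin d) → Fin K)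
    (x : EuclideanSpace ℝ (Fin d)) (j : Fin K) :
    kernelQuery k f (x, {j}ᶜ) = cosKernel K k (f x) j := by
  simp [kernelQuery]

variable (d K) in
/-- The standard Gaussian paired with the complement of an independent uniform label. -/
noncomputable def uniformContrastive :
    Measure (EuclideanSpace ℝ (Fin d) × Finset (Fin K)) :=
  contrastiveMeasure fun _ _ => (K : ℝ)⁻¹

lemma integral_uniformContrastive {q : EuclideanSpace ℝ (Fin d) × Finset (Fin K) → ℝ}
    (hq : IsBoundedMeasurable q) :
    ∫ p, q p ∂uniformContrastive d K =
      (K : ℝ)⁻¹ * ∑ j, ∫ x, q (x, {j}ᶜ) ∂stdGaussian (EuclideanSpace ℝ (Fin d)) := by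
  rw [uniformContrastive, integral_contrastiveMeasure (fun _ => IsBoundedMeasurable.const _)
    (fun _ _ => by positivity) hq, Finset.mul_sum]
  simp_rw [integral_const_mul]

/-- The contrastive label distribution of `f` in which label `j` is excluded with probability
`(1 - cos (2πk (f x - j) / K)) / K`. -/
noncomputable def kernelContrastive (k : ℕ) (f : EuclideanSpace ℝ (Fin d) → Fin K) :
    Measure (EuclideanSpace ℝ (Fin d) × Finset (Fin K)) :=
  contrastiveMeasure fun x j => (K : ℝ)⁻¹ * (1 - cosKernel K k (f x) j)

variable [NeZero K]

lemma isBoundedMeasurable_kernelQuery (k : ℕ) {f : EuclideanSpace ℝ (Fin d) → Fin K}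
    (hf : Measurable f) : IsBoundedMeasurable (kernelQuery k f) := by
  refine IsBoundedMeasurable.sum fun j => ⟨?_, 1, fun p => ?_⟩
  · refine Measurable.ite (measurable_snd (.of_discrete (s := {({j}ᶜ : Finset (Fin K))}))) ?_ measurable_const
    exact (IsBoundedMeasurable.cosKernel hf k j).measurable.comp measurable_fst
  · split_ifs
    · exact abs_cosKernel_le_one _ _ _
    · simp

instance : IsProbabilityMeasure (uniformContrastive d K) :=
  isProbabilityMeasure_contrastiveMeasure (fun _ => measurable_const) (fun _ _ => by positivity)
    fun _ => by simp [NeZero.ne K]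

lemma kernel_nonneg (k : ℕ) (i j : Fin K) : 0 ≤ (K : ℝ)⁻¹ * (1 - cosKernel K k i j) :=
  mul_nonneg (by positivity) (by linarith [(abs_le.mp (abs_cosKernel_le_one k i j)).2])

lemma sum_kernel {k : ℕ} (hk : k.Coprime K) (hK : 1 < K) (i : Fin K) :
    ∑ j, (K : ℝ)⁻¹ * (1 - cosKernel K k i j) = 1 := by
  rw [← Finset.mul_sum, Finset.sum_sub_distrib, sum_cosKernel hk hK]
  simp [NeZero.ne K]

lemma isBoundedMeasurable_kernel (k : ℕ) {f : EuclideanSpace ℝ (Fin d) → Fin K}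
    (hf : Measurable f) (j : Fin K) :
    IsBoundedMeasurable (fun x => (K : ℝ)⁻¹ * (1 - cosKernel K k (f x) j)) := by
  refine (IsBoundedMeasurable.const _).mul ⟨measurable_const.sub
    (IsBoundedMeasurable.cosKernel hf k j).measurable, 2, fun x => ?_⟩
  refine (abs_sub _ _).trans ?_
  rw [abs_one]
  linarith [abs_cosKernel_le_one k (f x) j]

lemma isProbabilityMeasure_kernelContrastive {k : ℕ} (hk : k.Coprime K) (hK : 1 < K)
    {f : EuclideanSpace ℝ (Fin d) → Fin K} (hf : Measurable f) :
    IsProbabilityMeasure (kernelContrastive k f) :=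
  isProbabilityMeasure_contrastiveMeasure (fun j => (isBoundedMeasurable_kernel k hf j).measurable)
    (fun _ j => kernel_nonneg k _ j) fun _ => sum_kernel hk hK _

lemma kernelContrastive_mem {k : ℕ} (hk : k.Coprime K) (hK : 1 < K)
    {f : EuclideanSpace ℝ (Fin d) → Fin K} (hf : Measurable f) (hlin : IsLinearClassifier f) {γ : ℝ}
    (hγ : γ ≤ 1 / (K : ℝ) ^ 3) : (kernelContrastive k f, f) ∈ contrastiveLabelInstances d K γ := by
  have hKpos : (0 : ℝ) < K := by exact_mod_cast NeZero.pos K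
  have hfst : (kernelContrastive k f).map Prod.fst = stdGaussian (EuclideanSpace ℝ (Fin d)) :=
    contrastiveMeasure_map_fst (fun j => (isBoundedMeasurable_kernel k hf j).measurable)
      (fun _ j => kernel_nonneg k _ j) fun _ => sum_kernel hk hK _
  have hconf : HasConfusionMatrix (kernelContrastive k f) f
      (contrastiveMatrix fun i j => (K : ℝ)⁻¹ * (1 - cosKernel K k i j)) :=
    hasConfusionMatrix_contrastiveMeasure (p := fun i j => (K : ℝ)⁻¹ * (1 - cosKernel K k i j))
      hf (kernel_nonneg k) (sum_kernel hk hK)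
  refine ⟨hlin, hfst, contrastiveMatrix fun i j => (K : ℝ)⁻¹ * (1 - cosKernel K k i j),
    isConfusionMatrix_contrastiveMatrix f (kernel_nonneg k) (sum_kernel hk hK) ?_ ?_,
    contrastiveMatrix_eq_zero, hconf⟩
  · intro i
    simp [cosKernel_self]
  · intro i j hij
    have h1 := two_div_sq_le_one_sub_cosKernel hk hij.symm
    calc γ ≤ 1 / (K : ℝ) ^ 3 := hγ
      _ ≤ (K : ℝ)⁻¹ * (2 / (K : ℝ) ^ 2) := by
        rw [show (K : ℝ)⁻¹ * (2 / (K : ℝ) ^ 2) = 2 / (K : ℝ) ^ 3 by field_simp]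
        gcongr
        norm_num
      _ ≤ _ := by gcongr

lemma integral_kernelContrastive (k : ℕ) {f : EuclideanSpace ℝ (Fin d) → Fin K}
    (hf : Measurable f) {q : EuclideanSpace ℝ (Fin d) × Finset (Fin K) → ℝ}
    (hq : IsBoundedMeasurable q) :
    ∫ p, q p ∂kernelContrastive k f =
      ∫ p, q p ∂uniformContrastive d K - ∫ p, q p * kernelQuery k f p ∂uniformContrastive d K := by
  have hqj (j : Fin K) : IsBoundedMeasurable (fun x => q (x, {j}ᶜ)) := by
    obtain ⟨C, hC⟩ := hq.bounded
    exact ⟨hq.measurable.comp measurable_prodMk_right, C, fun x => hC _⟩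
  rw [integral_uniformContrastive hq,
    integral_uniformContrastive (hq.mul (isBoundedMeasurable_kernelQuery k hf)),
    kernelContrastive, integral_contrastiveMeasure (fun j => isBoundedMeasurable_kernel k hf j)
    (fun x j => kernel_nonneg k _ j) hq, ← mul_sub, ← Finset.sum_sub_distrib, Finset.mul_sum]
  refine Finset.sum_congr rfl fun j _ => ?_
  simp_rw [kernelQuery_compl_singleton]
  rw [← integral_sub (hqj j).integrable
    ((hqj j).mul (IsBoundedMeasurable.cosKernel hf k j)).integrable, ← integral_const_mul]
  exact integral_congr_ae (.of_forall fun x => by ring)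

lemma integral_kernelQuery_mul (k : ℕ) {f f' : EuclideanSpace ℝ (Fin d) → Fin K}
    (hf : Measurable f) (hf' : Measurable f') :
    ∫ p, kernelQuery k f p * kernelQuery k f' p ∂uniformContrastive d K =
      (K : ℝ)⁻¹ * ∑ j, ∫ x, cosKernel K k (f x) j * cosKernel K k (f' x) j
        ∂stdGaussian (EuclideanSpace ℝ (Fin d)) := by
  rw [integral_uniformContrastive ((isBoundedMeasurable_kernelQuery k hf).mul
    (isBoundedMeasurable_kernelQuery k hf'))]
  simp_rw [kernelQuery_compl_singleton]

lemma abs_integral_kernelQuery_mul_le (k : ℕ) {f f' : EuclideanSpace ℝ (Fin d) → Fin K}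
    (hf : Measurable f) (hf' : Measurable f') {ε : ℝ}
    (h : ∀ j, |∫ x, cosKernel K k (f x) j * cosKernel K k (f' x) j
        ∂stdGaussian (EuclideanSpace ℝ (Fin d))| ≤ ε) :
    |∫ p, kernelQuery k f p * kernelQuery k f' p ∂uniformContrastive d K| ≤ ε := by
  have hKpos : (0 : ℝ) < K := by exact_mod_cast NeZero.pos K
  rw [integral_kernelQuery_mul k hf hf', abs_mul, abs_of_pos (inv_pos.mpr hKpos)]
  calc _ ≤ (K : ℝ)⁻¹ * ∑ _j : Fin K, ε := by
        gcongr
        exact (Finset.abs_sum_le_sum_abs _ _).trans (Finset.sum_le_sum fun j _ => h j)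
    _ = ε := by
        rw [Finset.sum_const, Finset.card_univ, Fintype.card_fin, nsmul_eq_mul]
        field_simp

lemma abs_integral_kernelQuery_mul_le_one (k : ℕ) {f f' : EuclideanSpace ℝ (Fin d) → Fin K}
    (hf : Measurable f) (hf' : Measurable f') :
    |∫ p, kernelQuery k f p * kernelQuery k f' p ∂uniformContrastive d K| ≤ 1 := by
  refine abs_integral_kernelQuery_mul_le k hf hf' fun j => ?_
  have := norm_integral_le_of_norm_le_const (μ := stdGaussian (EuclideanSpace ℝ (Fin d)))
    (f := fun x => cosKernel K k (f x) j * cosKernel K k (f' x) j) (C := 1)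
    (.of_forall fun x => abs_cosKernel_mul_le_one _ _ _ _ _)
  simpa using this

/-- A hypothesis that agrees with `f` most of the time has a query correlated with the labels. -/
lemma le_integral_kernelQuery_mul (k : ℕ) (hK : 2 ≤ K) {f h : EuclideanSpace ℝ (Fin d) → Fin K}
    (hf : Measurable f) (hh : Measurable h)
    (herr : stdGaussian (EuclideanSpace ℝ (Fin d)) {x | h x ≠ f x} ≤
      ENNReal.ofReal (1 / (2 * (K : ℝ)))) :
    1 / 8 ≤ ∫ p, kernelQuery k h p * kernelQuery k f p ∂uniformContrastive d K := by
  have hKpos : (0 : ℝ) < K := by exact_mod_cast NeZero.pos K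
  have hK2 : (2 : ℝ) ≤ K := by exact_mod_cast hK
  have hint (j : Fin K) := ((IsBoundedMeasurable.cosKernel hh k j).mul
    (IsBoundedMeasurable.cosKernel hf k j)).integrable
      (P := stdGaussian (EuclideanSpace ℝ (Fin d)))
  have hset : MeasurableSet {x | h x ≠ f x} := (measurableSet_eq_fun hh hf).compl
  rw [integral_kernelQuery_mul k hh hf, ← integral_finsetSum _ fun j _ => hint j,
    ← integral_const_mul]
  have hpt (x : EuclideanSpace ℝ (Fin d)) :
      1 / 2 - 3 / 2 * Set.indicator {x | h x ≠ f x} (1 : EuclideanSpace ℝ (Fin d) → ℝ) x ≤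
        (K : ℝ)⁻¹ * ∑ j, cosKernel K k (h x) j * cosKernel K k (f x) j := by
    by_cases hx : h x = f x
    · have h1 := le_sum_cosKernel_sq k (f x)
      have h2 : x ∉ {x | h x ≠ f x} := fun h => h hx
      rw [Set.indicator_of_notMem h2, hx, inv_mul_eq_div, le_div_iff₀ hKpos]
      simp_rw [← pow_two]
      linarith
    · have h2 : x ∈ {x | h x ≠ f x} := hx
      rw [Set.indicator_of_mem h2, inv_mul_eq_div, le_div_iff₀ hKpos]
      have h3 := Finset.card_nsmul_le_sum Finset.univ
        (fun j => cosKernel K k (h x) j * cosKernel K k (f x) j) (-1)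
        fun j _ => (abs_le.mp (abs_cosKernel_mul_le_one k (h x) (f x) j j)).1
      rw [Finset.card_univ, Fintype.card_fin, nsmul_eq_mul] at h3
      simp only [Pi.one_apply]
      linarith
  have hind : Integrable (Set.indicator {x | h x ≠ f x} (1 : EuclideanSpace ℝ (Fin d) → ℝ))
      (stdGaussian (EuclideanSpace ℝ (Fin d))) := (integrable_const 1).indicator hset
  have hlow : ∫ x, (1 / 2 - 3 / 2 * Set.indicator {x | h x ≠ f x}
      (1 : EuclideanSpace ℝ (Fin d) → ℝ) x) ∂stdGaussian (EuclideanSpace ℝ (Fin d)) =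
      1 / 2 - 3 / 2 * (stdGaussian (EuclideanSpace ℝ (Fin d))).real {x | h x ≠ f x} := by
    rw [integral_sub (integrable_const _) (hind.const_mul _), integral_const_mul,
      integral_indicator_one hset]
    simp
  have hreal : (stdGaussian (EuclideanSpace ℝ (Fin d))).real {x | h x ≠ f x} ≤ 1 / 4 := by
    refine (ENNReal.toReal_le_of_le_ofReal (by positivity) herr).trans ?_
    rw [div_le_div_iff₀ (by positivity) (by norm_num)]
    linarith
  have hmono := integral_mono ((integrable_const (1 / 2 : ℝ)).sub (hind.const_mul (3 / 2)))
    ((integrable_finsetSum Finset.univ fun j _ => hint j).const_mul (K : ℝ)⁻¹) hpt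
  simp only [Pi.sub_apply] at hmono
  rw [hlow] at hmono
  linarith

end hard

/-- Learning requires at least as much on a larger set of instances. -/
lemma LearningRequires.mono {d K : ℕ}
    {I I' : Set (Measure (EuclideanSpace ℝ (Fin d) × Finset (Fin K)) ×
      (EuclideanSpace ℝ (Fin d) → Fin K))} (hI : I ⊆ I') {ε N U : ℝ}
    (h : LearningRequires.{u} I ε N U) : LearningRequires.{u} I' ε N U := by
  intro Ω _ μ _ A hA
  obtain ⟨D, f, hD, hO⟩ := h Ω μ A fun D f hDf => hA D f (hI hDf)
  exact ⟨D, f, hI hD, hO⟩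

lemma contrastiveLabelInstances_subset (d K : ℕ) (γ : ℝ) :
    contrastiveLabelInstances d K γ ⊆ partialLabelInstances d K γ :=
  fun _ ⟨h1, h2, H, h3, _, h4⟩ => ⟨h1, h2, H, h3, h4⟩

/-- The lower bound for contrastive labels, with explicit parameters. -/
lemma exists_learningRequires_contrastive :
    ∃ M C₁ : ℝ, 1 ≤ M ∧ 1 ≤ C₁ ∧ ∀ (d n K k : ℕ), 2 ≤ K → 0 < n → 2 * n ≤ d → k.Coprime K →
      2 * k ≤ K → ∀ γ : ℝ, γ ≤ 1 / (K : ℝ) ^ 3 → ∀ t N U : ℝ, 0 ≤ t → t < 1 → 1 ≤ N → 0 < U →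
        64 * (U + 1) * (M * (C₁ * t) ^ k + 24 * N * Real.exp (-(n * t ^ 2 / 2))) ≤ 1 →
        LearningRequires.{u} (contrastiveLabelInstances d K γ) (1 / (2 * (K : ℝ))) N U := by
  obtain ⟨M, C₁, hM, hC₁, hcor⟩ := exists_abs_integral_cosKernel_mul_le
  refine ⟨M, C₁, hM, hC₁, ?_⟩
  intro d n K k hK hn hnd hkK hk γ hγ t N U ht ht1 hN hU hcond
  have : NeZero K := ⟨by omega⟩
  obtain ⟨emb⟩ : Nonempty (Fin n ⊕ Fin n ↪ Fin d) :=
    Function.Embedding.nonempty_of_card_le (by simp; omega)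
  set e : Fin n ⊕ Fin n → EuclideanSpace ℝ (Fin d) := fun i =>
    EuclideanSpace.basisFun (Fin d) ℝ (emb i)
  have he : Orthonormal ℝ e :=
    (EuclideanSpace.basisFun (Fin d) ℝ).orthonormal.comp emb emb.injective
  set f : (Fin n → Bool) → EuclideanSpace ℝ (Fin d) → Fin K := sectorClassifier K e
  have hf (v) : Measurable (f v) := measurable_sectorClassifier e v
  set g : (Fin n → Bool) → EuclideanSpace ℝ (Fin d) × Finset (Fin K) → ℝ :=
    fun v => kernelQuery k (f v)
  have hg (v) : IsBoundedMeasurable (g v) := isBoundedMeasurable_kernelQuery k (hf v)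
  set τ := 1 / (12 * N) with hτ
  have hτ0 : 0 < τ := by positivity
  set ε := M * (C₁ * t) ^ k + 2 * Real.exp (-(n * t ^ 2 / 2)) / τ with hε
  have hcond' : 64 * (U + 1) * ε ≤ 1 := by
    refine le_trans (le_of_eq ?_) hcond
    rw [hε, hτ]
    field_simp
    ring
  have hε0 : 0 ≤ ε := by positivity
  have hcard : (Fintype.card (Fin n → Bool) : ℝ) = 2 ^ n := by simp
  have hcorr : HasSmallCorrelations (uniformContrastive d K) g τ ε := by
    intro B hB
    rw [hcard] at hB
    refine sum_sum_le_of_signCorr ht (by positivity) hτ0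
      (fun v v' => abs_integral_kernelQuery_mul_le_one k (hf v) (hf v')) (fun v v' hvv' => ?_) B hB
    refine abs_integral_kernelQuery_mul_le k (hf v) (hf v') fun j => ?_
    refine (hcor d n K k hn hk e he v v' (hvv'.trans_lt ht1) j).trans ?_
    gcongr
  intro Ω _ μ _ A hA
  by_contra! hno
  have hP (v) : IsProbabilityMeasure (kernelContrastive k (f v)) :=
    isProbabilityMeasure_kernelContrastive hkK (by omega) (hf v)
  have hmem (v) : (kernelContrastive k (f v), f v) ∈ contrastiveLabelInstances d K γ :=
    kernelContrastive_mem hkK (by omega) (hf v) (isLinearClassifier_sectorClassifier e v) hγ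
  have hN0 : (⌊N⌋₊ : ℝ) ≤ N := Nat.floor_le (by linarith)
  obtain ⟨h, B, hB, hBR⟩ := exists_common_output (P₀ := uniformContrastive d K)
    (P := fun v => kernelContrastive k (f v)) (δ := 2 * τ) (U := U) (M := ⌊N⌋₊) (μ := μ)
    (fun q u hu huU => hcorr.card_not_valid_le hε0 hτ0 hg
      (fun v q hq => integral_kernelContrastive k (hf v) hq) q hu (by
        refine le_trans ?_ hcond'
        gcongr
        norm_num))
    (by positivity)
    (by
      calc (⌊N⌋₊ : ℝ) * (2 * τ) ≤ N * (2 * τ) := by gcongr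
        _ = 1 / 6 := by rw [hτ]; field_simp; norm_num)
    A (fun v h => stdGaussian (EuclideanSpace ℝ (Fin d)) {x | h.1 x ≠ f v x} ≤
      ENNReal.ofReal (1 / (2 * (K : ℝ))))
    (fun v O hO => hA _ _ (hmem v) O hO)
    (fun v O hO => by
      refine measure_mono_null ?_ (le_zero_iff.mp (hno _ _ (hmem v) O hO))
      rintro ω (hω | hω)
      · exact .inl ((Nat.floor_lt' (by
          have : 0 < ((A ω).queries O).length := by
            have : (0 : ℝ) < ((A ω).queries O).length := lt_of_le_of_lt (by positivity) hω
            exact_mod_cast this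
          omega)).mp (by exact_mod_cast hω)).le
      · exact .inr hω)
  have hτ2 : τ ≤ 1 / 2 := by
    rw [hτ]
    gcongr
    linarith
  have hBτ : τ * Fintype.card (Fin n → Bool) ≤ B.card := by
    refine le_trans ?_ hB
    rw [div_eq_mul_one_div, mul_comm]
    gcongr
  have hne : B.Nonempty := by
    rw [← Finset.card_pos]
    have : (0 : ℝ) < B.card := lt_of_lt_of_le (by rw [hcard]; positivity) hBτ
    exact_mod_cast this
  have hQ := isBoundedMeasurable_kernelQuery (d := d) k h.2
  obtain ⟨v, hv, hle⟩ := hcorr.exists_sq_integral_mul_le hε0 hg hQ hBτ hne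
  have h1 := le_integral_kernelQuery_mul k hK (hf v) h.2 (hBR v hv)
  have h2 : ∫ p, kernelQuery k h.1 p ^ 2 ∂uniformContrastive d K ≤ 1 := by
    have := (abs_le.mp (abs_integral_kernelQuery_mul_le_one (d := d) k h.2 h.2)).2
    simpa only [pow_two] using this
  have h3 : (1 / 8 : ℝ) ^ 2 ≤ ε * 1 :=
    (pow_le_pow_left₀ (by norm_num) h1 2).trans (hle.trans (by gcongr))
  nlinarith

/-! ### Choice of parameters -/

lemma eventually_mul_rpow_mul_exp_le {α : ℝ} (hα : 0 < α) (hα1 : α < 1) :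
    ∀ᶠ x : ℝ in Filter.atTop, Real.log 6144 + x ^ α * Real.log x + x ^ ((1 - α) / 48) ≤
      x ^ ((1 + α) / 2) / 8 := by
  have h1 : ∀ᶠ x : ℝ in Filter.atTop, 24 * Real.log 6144 ≤ x ^ ((1 + α) / 2) :=
    (tendsto_rpow_atTop (by linarith)).eventually_ge_atTop _
  have h2 := (isLittleO_log_rpow_atTop (r := (1 - α) / 2) (by linarith)).bound
    (c := 1 / 24) (by norm_num)
  have h3 : ∀ᶠ x : ℝ in Filter.atTop, 24 ≤ x ^ ((1 + α) / 2 - (1 - α) / 48) :=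
    (tendsto_rpow_atTop (by linarith)).eventually_ge_atTop _
  filter_upwards [h1, h2, h3, Filter.eventually_gt_atTop 1] with x h1 h2 h3 hx
  have hx0 : 0 < x := by linarith
  have h4 : x ^ α * Real.log x ≤ x ^ ((1 + α) / 2) / 24 := by
    rw [Real.norm_of_nonneg (Real.log_nonneg hx.le), Real.norm_of_nonneg (by positivity)] at h2
    calc x ^ α * Real.log x ≤ x ^ α * (1 / 24 * x ^ ((1 - α) / 2)) := by gcongr
      _ = x ^ α * x ^ ((1 - α) / 2) / 24 := by ring
      _ = _ := by rw [← Real.rpow_add hx0]; congr 2; ring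
  have h5 : x ^ ((1 - α) / 48) ≤ x ^ ((1 + α) / 2) / 24 := by
    rw [le_div_iff₀ (by norm_num), mul_comm]
    calc 24 * x ^ ((1 - α) / 48) ≤
          x ^ ((1 + α) / 2 - (1 - α) / 48) * x ^ ((1 - α) / 48) := by gcongr
      _ = _ := by rw [← Real.rpow_add hx0]; congr 1; ring
  linarith

lemma query_parameter_bound {α x M C₁ κ n : ℝ} {k : ℕ} (hα : 0 < α) (hα1 : α < 1)
    (hx : 1 < x) (hM : 1 ≤ M) (hC₁ : 1 ≤ C₁) (hk : 0 < k) (hκ0 : 0 ≤ κ) (hκ : κ ≤ x ^ α)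
    (hκk : κ ≤ 6 * k) (hn : x / 4 ≤ n)
    (hx1 : 256 * (M * C₁) ≤ x ^ ((1 - α) / 8))
    (hx2 : Real.log 6144 + x ^ α * Real.log x + x ^ ((1 - α) / 48) ≤ x ^ ((1 + α) / 2) / 8) :
    64 * (x ^ ((1 - α) / 48 * κ) + 1) * (M * (C₁ * x ^ (-((1 - α) / 4))) ^ k +
      24 * (2 : ℝ) ^ (x ^ ((1 - α) / 48)) *
        Real.exp (-(n * (x ^ (-((1 - α) / 4))) ^ 2 / 2))) ≤ 1 := by
  have hx0 : 0 < x := by linarith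
  set U := x ^ ((1 - α) / 48 * κ) with hU
  have hc : 0 ≤ (1 - α) / 48 := by linarith
  have hU1 : 1 ≤ U := Real.one_le_rpow hx.le (by positivity)
  have hk1 : (1 : ℝ) ≤ k := by exact_mod_cast hk
  have hfirst : 128 * U * (M * (C₁ * x ^ (-((1 - α) / 4))) ^ k) ≤ 1 / 2 := by
    have hUk : U ≤ (x ^ ((1 - α) / 8)) ^ k := by
      rw [← Real.rpow_natCast, ← Real.rpow_mul hx0.le, hU]
      apply Real.rpow_le_rpow_of_exponent_le hx.le
      nlinarith
    have hMk : 128 * M ≤ (128 * M) ^ k := le_self_pow₀ (by linarith) hk.ne'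
    have hbase : 128 * M * (x ^ ((1 - α) / 8) * (C₁ * x ^ (-((1 - α) / 4)))) ≤ 1 / 2 := by
      have h1 : x ^ ((1 - α) / 8) * x ^ (-((1 - α) / 4)) = (x ^ ((1 - α) / 8))⁻¹ := by
        rw [← Real.rpow_add hx0, ← Real.rpow_neg hx0.le]
        congr 1
        ring
      calc _ = 128 * (M * C₁) * (x ^ ((1 - α) / 8) * x ^ (-((1 - α) / 4))) := by ring
        _ = 128 * (M * C₁) / x ^ ((1 - α) / 8) := by rw [h1, ← div_eq_mul_inv]
        _ ≤ 1 / 2 := by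
          rw [div_le_iff₀ (by positivity)]
          linarith
    calc _ = 128 * M * (U * (C₁ * x ^ (-((1 - α) / 4))) ^ k) := by ring
      _ ≤ (128 * M) ^ k * ((x ^ ((1 - α) / 8)) ^ k * (C₁ * x ^ (-((1 - α) / 4))) ^ k) := by gcongr
      _ = (128 * M * (x ^ ((1 - α) / 8) * (C₁ * x ^ (-((1 - α) / 4))))) ^ k := by
        rw [← mul_pow, ← mul_pow]
      _ ≤ 128 * M * (x ^ ((1 - α) / 8) * (C₁ * x ^ (-((1 - α) / 4)))) :=
        pow_le_of_le_one (by positivity) (by linarith) hk.ne'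
      _ ≤ 1 / 2 := hbase
  have hsecond : 128 * U * (24 * (2 : ℝ) ^ (x ^ ((1 - α) / 48)) *
      Real.exp (-(n * (x ^ (-((1 - α) / 4))) ^ 2 / 2))) ≤ 1 / 2 := by
    have h1 : U ≤ Real.exp (x ^ α * Real.log x) := by
      rw [hU, Real.rpow_def_of_pos hx0, mul_comm]
      apply Real.exp_le_exp.mpr
      refine mul_le_mul_of_nonneg_right ?_ (Real.log_nonneg hx.le)
      nlinarith
    have h2 : (2 : ℝ) ^ (x ^ ((1 - α) / 48)) ≤ Real.exp (x ^ ((1 - α) / 48)) := by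
      rw [Real.rpow_def_of_pos (by norm_num)]
      apply Real.exp_le_exp.mpr
      have := Real.log_two_lt_d9
      have h3 : 0 ≤ x ^ ((1 - α) / 48) := by positivity
      nlinarith
    have h3 : x ^ ((1 + α) / 2) / 8 ≤ n * (x ^ (-((1 - α) / 4))) ^ 2 / 2 := by
      have h4 : x * (x ^ (-((1 - α) / 4))) ^ 2 = x ^ ((1 + α) / 2) := by
        rw [← Real.rpow_natCast, ← Real.rpow_mul hx0.le, ← Real.rpow_one_add' hx0.le
          (by push_cast; linarith)]
        congr 1
        push_cast
        ring
      calc _ = x / 4 * (x ^ (-((1 - α) / 4))) ^ 2 / 2 := by rw [← h4]; ring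
        _ ≤ _ := by gcongr
    calc _ ≤ 128 * Real.exp (x ^ α * Real.log x) * (24 * Real.exp (x ^ ((1 - α) / 48)) *
          Real.exp (-(x ^ ((1 + α) / 2) / 8))) := by gcongr
      _ = 1 / 2 * (Real.exp (Real.log 6144) * Real.exp (x ^ α * Real.log x) *
          Real.exp (x ^ ((1 - α) / 48)) * Real.exp (-(x ^ ((1 + α) / 2) / 8))) := by
        rw [Real.exp_log (by norm_num)]
        ring
      _ = 1 / 2 * Real.exp (Real.log 6144 + x ^ α * Real.log x + x ^ ((1 - α) / 48) +
          -(x ^ ((1 + α) / 2) / 8)) := by rw [Real.exp_add, Real.exp_add, Real.exp_add]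
      _ ≤ 1 / 2 * 1 := by
        gcongr
        exact Real.exp_le_one_iff.mpr (by linarith)
      _ = 1 / 2 := by norm_num
  have hpos : 0 ≤ M * (C₁ * x ^ (-((1 - α) / 4))) ^ k + 24 * (2 : ℝ) ^ (x ^ ((1 - α) / 48)) *
      Real.exp (-(n * (x ^ (-((1 - α) / 4))) ^ 2 / 2)) := by positivity
  calc _ ≤ 64 * (U + U) * (M * (C₁ * x ^ (-((1 - α) / 4))) ^ k +
        24 * (2 : ℝ) ^ (x ^ ((1 - α) / 48)) *
        Real.exp (-(n * (x ^ (-((1 - α) / 4))) ^ 2 / 2))) := by gcongr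
    _ ≤ 1 := by linarith

theorem theoremE2 :
    ∃ C : ℕ, ∀ α : ℝ, 0 < α → α < 1 → ∃ c : ℝ, 0 < c ∧ ∃ d₀ : ℕ,
      ∀ d K : ℕ, d₀ ≤ d → 2 ≤ K → (K : ℝ) ≤ (d : ℝ) ^ α →
        ∀ γ : ℝ, 0 < γ → γ ≤ 1 / (K : ℝ) ^ C →
          LearningRequires.{u} (partialLabelInstances d K γ) (1 / (2 * (K : ℝ)))
              ((2 : ℝ) ^ ((d : ℝ) ^ c)) ((d : ℝ) ^ (c * (K : ℝ))) ∧
            LearningRequires.{u} (contrastiveLabelInstances d K γ) (1 / (2 * (K : ℝ)))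
              ((2 : ℝ) ^ ((d : ℝ) ^ c)) ((d : ℝ) ^ (c * (K : ℝ))) := by
  obtain ⟨M, C₁, hM, hC₁, hmain⟩ := exists_learningRequires_contrastive.{u}
  refine ⟨3, fun α hα hα1 => ⟨(1 - α) / 48, by linarith, ?_⟩⟩
  have h1 : ∀ᶠ x : ℝ in Filter.atTop, 256 * (M * C₁) ≤ x ^ ((1 - α) / 8) :=
    (tendsto_rpow_atTop (by linarith)).eventually_ge_atTop _
  obtain ⟨d₀, hd₀⟩ := Filter.eventually_atTop.mp (tendsto_natCast_atTop_atTop.eventually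
    (h1.and (eventually_mul_rpow_mul_exp_le hα hα1)))
  refine ⟨max d₀ 2, fun d K hd hK hKd γ _ hγ => ?_⟩
  have hd2 : 2 ≤ d := (le_max_right _ _).trans hd
  obtain ⟨hx1, hx2⟩ := hd₀ d ((le_max_left _ _).trans hd)
  have hx : (1 : ℝ) < d := by exact_mod_cast hd2
  obtain ⟨k, hk0, hkK, hk2, hk6⟩ := exists_coprime_frequency hK
  have hn : (d : ℝ) / 4 ≤ (d / 2 : ℕ) := by
    have h4 : d ≤ 4 * (d / 2) := by omega
    have : (d : ℝ) ≤ 4 * (d / 2 : ℕ) := by exact_mod_cast h4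
    linarith
  have hcon := hmain d (d / 2) K k hK (by omega) (by omega) hkK hk2 γ hγ
    ((d : ℝ) ^ (-((1 - α) / 4))) ((2 : ℝ) ^ ((d : ℝ) ^ ((1 - α) / 48)))
    ((d : ℝ) ^ ((1 - α) / 48 * (K : ℝ))) (by positivity)
    (Real.rpow_lt_one_of_one_lt_of_neg hx (by linarith))
    (Real.one_le_rpow (by norm_num) (by positivity)) (by positivity)
    (query_parameter_bound hα hα1 hx hM hC₁ hk0 (Nat.cast_nonneg K) hKd (by exact_mod_cast hk6)
      hn hx1 hx2)
  exact ⟨hcon.mono (contrastiveLabelInstances_subset d K γ), hcon⟩
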